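/- \textbf{Setting.} Let $({\bf x}_i,{\bf s}_i,y_i,R_i)$, $i=1,2,\dots$, be independent copies of $({\bf x},{\bf s},y,R)$ with ${\bf x}\in\mathbb R^p$, ${\bf s}=(s^{(1)},\dots,s^{(K)})\in\mathbb R^K$, $y\in\mathbb R$, $R\in\{0,1\}$, where $P(R=1\mid {\bf x},{\bf s},y)=\rho({\bf x},{\bf s})$ and the known measurable labeling rule $\rho$ satisfies $\rho\ge\varepsilon$ for some constant $\varepsilon>0$. For a sample of size $N$ let $\mathcal V=\{i\le N: R_i=1\}$, $n=|\mathcal V|$, and $r=\mathbb E\{\rho({\bf x},{\bf s})\}$; asymptotics are for $N\to\infty$ with $p,K,d,\rho$ fixed. Let ${\bf m}(\boldsymbol\beta;y,{\bf x})\in\mathbb R^p$ and ${\bf h}(\boldsymbol\theta;s,{\bf x})\in\mathbb R^d$ be estimating functions with $\mathbb E\{{\bf m}(\boldsymbol\beta_0;y,{\bf x})\}={\bf 0}$ and $\mathbb E\{{\bf h}(\boldsymbol\theta_0^{(k)};s^{(k)},{\bf x})\}={\bf 0}$, $k=1,\dots,K$. \textbf{Regularity conditions.} For each of the $K+1$ pairs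 (estimating function ${\bf g}(t;z)$, true value $t_0$), namely $({\bf m},\boldsymbol\beta_0)$ with $z=(y,{\bf x})$ and $({\bf h},\boldsymbol\theta_0^{(k)})$ with $z=(s^{(k)},{\bf x})$: the parameter set $B$ is compact with $t_0$ in its interior; ${\bf g}(t;\cdot)$ is measurable, and almost surely $t\mapsto{\bf g}(t;z)$ is continuous on $B$; $\sup_{t\in B}\|{\bf g}(t;z)\|$ is dominated by an integrable function of $z$; $t_0$ is the only zero of $t\mapsto\mathbb E\{{\bf g}(t;z)\}$ in $B$; $\mathbb E\|{\bf g}(t_0;z)\|^2<\infty$; on some neighbourhood of $t_0$, ${\bf g}(\cdot\,;z)$ is almost surely continuously differentiable with derivative dominated by an integrable function of $z$; and $\mathbb E\{\partial{\bf g}(t_0;z)/\partial t^{\rm T}\}$ is invertible. \textbf{Estimators.} With probability tending to one, $\hat{\boldsymbol\beta}_{\mathcal V}$, $\hat{\boldsymbol\theta}^{(k)}_{\mathcal V}$, $\hat{\boldsymbol\theta}^{(k)}_{\mathcal F}$ lie in the respective parameter sets and solve $$\frac1N\sum_{i\in\mathcal V}\frac{{\bf m}(\boldsymbol\beta;y_i,{\bf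 x}_i)}{\rho({\bf x}_i,{\bf s}_i)}={\bf 0},\qquad \frac1N\sum_{i\in\mathcal V}\frac{{\bf h}(\boldsymbol\theta^{(k)};s^{(k)}_i,{\bf x}_i)}{\rho({\bf x}_i,{\bf s}_i)}={\bf 0},\qquad \frac1N\sum_{i=1}^N{\bf h}(\boldsymbol\theta^{(k)};s_i^{(k)},{\bf x}_i)={\bf 0}.$$ Stack the $\boldsymbol\theta$'s over $k$ into vectors of $\mathbb R^{q}$, $q=dK$, fix $\boldsymbol\Gamma\in\mathbb R^{p\times q}$, and put $\hat{\boldsymbol\beta}=\hat{\boldsymbol\beta}_{\mathcal V}-\boldsymbol\Gamma(\hat{\boldsymbol\theta}_{\mathcal V}-\hat{\boldsymbol\theta}_{\mathcal F})$. Let $\boldsymbol\psi=-[\mathbb E\{\partial{\bf m}(\boldsymbol\beta_0;y,{\bf x})/\partial\boldsymbol\beta^{\rm T}\}]^{-1}{\bf m}(\boldsymbol\beta_0;y,{\bf x})$, let $\boldsymbol\eta^{(k)}=-[\mathbb E\{\partial{\bf h}(\boldsymbol\theta^{(k)}_0;s^{(k)},{\bf x})/\partial\boldsymbol\theta^{\rm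 T}\}]^{-1}{\bf h}(\boldsymbol\theta_0^{(k)};s^{(k)},{\bf x})$, and let $\boldsymbol\eta\in\mathbb R^q$ be the stacked vector of the $\boldsymbol\eta^{(k)}$. We say that $\boldsymbol\phi$ is the influence function of estimators $\hat t$ of $t_0$ if $\mathbb E\boldsymbol\phi={\bf 0}$, $\mathbb E\|\boldsymbol\phi\|^2<\infty$ and $\sqrt N(\hat t-t_0)=N^{-1/2}\sum_{i=1}^N\boldsymbol\phi_i+o_P(1)$. \textbf{Conclusion.} The functions $\boldsymbol\psi$ and $\boldsymbol\eta^{(k)}$ are the full data influence functions, that is, the influence functions of every full data estimator $\hat{\boldsymbol\beta}_{\mathcal F}$ (defined by $\frac1N\sum_{i=1}^N{\bf m}(\boldsymbol\beta;y_i,{\bf x}_i)={\bf 0}$ in the same sense) and of $\hat{\boldsymbol\theta}^{(k)}_{\mathcal F}$. The influence function of $\hat{\boldsymbol\beta}$ is $$\tilde{\boldsymbol\psi}=\frac{R\boldsymbol\psi}{\rho({\bf x},{\bf s})}+\frac{\rho({\bf x},{\bf s})-R}{\rho({\bf x},{\bf s})}\boldsymbol\Gamma\boldsymbol\eta ,$$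 $$\sqrt n(\hat{\boldsymbol\beta}-\boldsymbol\beta_0)\xrightarrow{d}N({\bf 0},\,r\,\mathrm{Var}(\tilde{\boldsymbol\psi})),$$ and $$\mathrm{Var}(\tilde{\boldsymbol\psi})=\mathbb E\Bigl\{\frac1{\rho({\bf x},{\bf s})}\boldsymbol\psi\boldsymbol\psi^{\rm T}\Bigr\}-\mathbb E\Bigl\{\frac{1-\rho({\bf x},{\bf s})}{\rho({\bf x},{\bf s})}\bigl(\boldsymbol\psi\boldsymbol\eta^{\rm T}\boldsymbol\Gamma^{\rm T}+\boldsymbol\Gamma\boldsymbol\eta\boldsymbol\psi^{\rm T}-\boldsymbol\Gamma\boldsymbol\eta\boldsymbol\eta^{\rm T}\boldsymbol\Gamma^{\rm T}\bigr)\Bigr\}.$$ -/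

import Mathlib

open MeasureTheory ProbabilityTheory Filter Topology

noncomputable section

namespace SPI

/-- `ℝⁿ` with its Euclidean norm. -/
abbrev Vec (n : ℕ) : Type := EuclideanSpace ℝ (Fin n)

/-- The space of stacked nuisance parameters `θ = (θ⁽¹⁾, …, θ⁽ᴷ⁾) ∈ ℝ^{dK}`; the coordinate `(k, j)`
is the `j`-th coordinate of `θ⁽ᵏ⁾`. -/
abbrev StackedVec (K d : ℕ) : Type := EuclideanSpace ℝ (Fin K × Fin d)

/-- Stacking of `K` vectors of `ℝᵈ` into one vector of `ℝ^{dK}`. -/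
def stack {K d : ℕ} (v : Fin K → Vec d) : StackedVec K d :=
  WithLp.toLp 2 (fun kj => v kj.1 kj.2)

/-- One full observation `(x, s, y, R)`. The label `y` is available to the statistician only if
`R = 1`; the estimators on the validation set use it only for such subjects. -/
abbrev Obs (p K : ℕ) : Type := Vec p × Vec K × ℝ × ℝ

/-- The argument `(y, x)` of the estimating function `m`, read off from an observation. -/
def labelData {p K : ℕ} (w : Obs p K) : ℝ × Vec p := (w.2.2.1, w.1)

/-- The argument `(s⁽ᵏ⁾, x)` of the estimating function `h`, read off from an observation. -/
def surrogateData {p K : ℕ} (k : Fin K) (w : Obs p K) : ℝ × Vec p := (w.2.1 k, w.1)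

section Sampling

variable {Ω : Type*} [MeasurableSpace Ω]

/-- The `i`-th observation as a random element. -/
def obs {p K : ℕ} (X : ℕ → Ω → Vec p) (S : ℕ → Ω → Vec K) (Y R : ℕ → Ω → ℝ) (i : ℕ) (ω : Ω) :
    Obs p K := (X i ω, S i ω, Y i ω, R i ω)

/-- The sampling design: independent copies of `(x, s, y, R)`, where the labeling indicator `R`
satisfies `P(R = 1 ∣ x, s, y) = ρ(x, s)` (independent Poisson sampling with a selection probability
that depends on the fully observed data only), and `ρ` is bounded away from zero. -/
structure IsPoissonDesign {p K : ℕ} (μ : Measure Ω) (X : ℕ → Ω → Vec p) (S : ℕ → Ω → Vec K)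
    (Y R : ℕ → Ω → ℝ) (ρ : Vec p → Vec K → ℝ) : Prop where
  measurable_X : ∀ i, Measurable (X i)
  measurable_S : ∀ i, Measurable (S i)
  measurable_Y : ∀ i, Measurable (Y i)
  measurable_R : ∀ i, Measurable (R i)
  binary : ∀ i ω, R i ω = 0 ∨ R i ω = 1
  indep : iIndepFun (obs X S Y R) μ
  ident : ∀ i, IdentDistrib (obs X S Y R i) (obs X S Y R 0) μ μ
  measurable_rho : Measurable (fun z : Vec p × Vec K => ρ z.1 z.2)
  positivity : ∃ ε : ℝ, 0 < ε ∧ ∀ x s, ε ≤ ρ x s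
  selection : ∀ i,
    μ[R i | MeasurableSpace.comap (fun ω => (X i ω, S i ω, Y i ω)) inferInstance]
      =ᵐ[μ] fun ω => ρ (X i ω) (S i ω)

open Classical in
/-- The validation set `𝒱` among the first `N` subjects. -/
def validationSet (R : ℕ → Ω → ℝ) (N : ℕ) (ω : Ω) : Finset ℕ :=
  (Finset.range N).filter (fun i => R i ω = 1)

/-- The inverse-probability-weighted estimating function on the validation set,
`N⁻¹ ∑_{i ∈ 𝒱} ρ(xᵢ, sᵢ)⁻¹ g(t; zᵢ)`, where `zᵢ = z(wᵢ)` is a part of the `i`-th observation. -/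
def validationEq {p K e : ℕ} {Z : Type*} (X : ℕ → Ω → Vec p) (S : ℕ → Ω → Vec K) (Y R : ℕ → Ω → ℝ)
    (ρ : Vec p → Vec K → ℝ) (z : Obs p K → Z) (g : Vec e → Z → Vec e)
    (N : ℕ) (ω : Ω) (t : Vec e) : Vec e :=
  (1 / (N : ℝ)) • ∑ i ∈ validationSet R N ω, (1 / ρ (X i ω) (S i ω)) • g t (z (obs X S Y R i ω))

/-- The estimating function on the full data, `N⁻¹ ∑_{i ≤ N} g(t; zᵢ)`. -/
def fullEq {p K e : ℕ} {Z : Type*} (X : ℕ → Ω → Vec p) (S : ℕ → Ω → Vec K) (Y R : ℕ → Ω → ℝ)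
    (z : Obs p K → Z) (g : Vec e → Z → Vec e) (N : ℕ) (ω : Ω) (t : Vec e) : Vec e :=
  (1 / (N : ℝ)) • ∑ i ∈ Finset.range N, g t (z (obs X S Y R i ω))

/-- `est N` is a (random) solution of the estimating equation `Ψ N ω t = 0` in the parameter
set `B`. As usual, it has to exist only with probability tending to one. -/
structure IsSolution {e : ℕ} (μ : Measure Ω) (B : Set (Vec e)) (Ψ : ℕ → Ω → Vec e → Vec e)
    (est : ℕ → Ω → Vec e) : Prop where
  aemeasurable : ∀ N, AEMeasurable (est N) μ
  solves : Tendsto (fun N => μ {ω | ¬ (est N ω ∈ B ∧ Ψ N ω (est N ω) = 0)}) atTop (𝓝 0)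

/-- The regularity conditions for an estimating function `g(t; z)`, where `z` has law `ν`, with
parameter set `B` and true value `t₀`. These are the classical conditions for `M`-estimators; they
concern the full data only, and neither consistency nor asymptotic linearity is part of them. -/
structure IsRegular {e : ℕ} {Z : Type*} [MeasurableSpace Z] (ν : Measure Z)
    (g : Vec e → Z → Vec e) (B : Set (Vec e)) (t₀ : Vec e) : Prop where
  isCompact : IsCompact B
  mem_interior : t₀ ∈ interior B
  measurable : ∀ t, Measurable (g t)
  continuousOn : ∀ᵐ z ∂ν, ContinuousOn (fun t => g t z) B
  envelope : ∃ F : Z → ℝ, Integrable F ν ∧ ∀ᵐ z ∂ν, ∀ t ∈ B, ‖g t z‖ ≤ F z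
  moment_zero : ∫ z, g t₀ z ∂ν = 0
  identification : ∀ t ∈ B, ∫ z, g t z ∂ν = 0 → t = t₀
  square_integrable : MemLp (g t₀) 2 ν
  smooth : ∃ U : Set (Vec e), IsOpen U ∧ t₀ ∈ U ∧
    (∀ᵐ z ∂ν, ContDiffOn ℝ 1 (fun t => g t z) U) ∧
    ∃ G : Z → ℝ, Integrable G ν ∧ ∀ᵐ z ∂ν, ∀ t ∈ U, ‖fderiv ℝ (fun t => g t z) t‖ ≤ G z
  jacobian_invertible : (∫ z, fderiv ℝ (fun t => g t z) t₀ ∂ν).IsInvertible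

/-- The full data influence function `z ↦ -(E ∂g(t₀; z)/∂tᵀ)⁻¹ g(t₀; z)` of the parameter `t₀`
defined by `E g(t₀; z) = 0`. -/
def fullInfluence {e : ℕ} {Z : Type*} [MeasurableSpace Z] (ν : Measure Z)
    (g : Vec e → Z → Vec e) (t₀ : Vec e) (z : Z) : Vec e :=
  -(∫ z', fderiv ℝ (fun t => g t z') t₀ ∂ν).inverse (g t₀ z)

/-- `φ` is the influence function of the estimators `est` of `t₀`: `φ(w)` is square-integrable with
mean zero, and `√N (est_N - t₀) = N^{-1/2} ∑_{i ≤ N} φ(wᵢ) + o_P(1)`. -/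
structure IsInfluenceFunction {e : ℕ} {W : Type*} (μ : Measure Ω) (w : ℕ → Ω → W)
    (est : ℕ → Ω → Vec e) (t₀ : Vec e) (φ : W → Vec e) : Prop where
  memLp : ∀ i, MemLp (fun ω => φ (w i ω)) 2 μ
  mean_zero : ∀ i, ∫ ω, φ (w i ω) ∂μ = 0
  expansion : TendstoInMeasure μ
    (fun (N : ℕ) ω => √(N : ℝ) • (est N ω - t₀) - (√(N : ℝ))⁻¹ • ∑ i ∈ Finset.range N, φ (w i ω))
    atTop (fun _ => 0)

/-- The action of a `p × dK` matrix on a stacked vector. -/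
def matVec {p K d : ℕ} (Γ : Matrix (Fin p) (Fin K × Fin d) ℝ) (v : StackedVec K d) : Vec p :=
  WithLp.toLp 2 (Γ.mulVec v.ofLp)

/-- The surrogate-powered estimator `β̂ = β̂_𝒱 - Γ (θ̂_𝒱 - θ̂_ℱ)`. -/
def spiEstimator {p K d : ℕ} (Γ : Matrix (Fin p) (Fin K × Fin d) ℝ) (βV : ℕ → Ω → Vec p)
    (θV θF : Fin K → ℕ → Ω → Vec d) (N : ℕ) (ω : Ω) : Vec p :=
  βV N ω - matVec Γ (stack (fun k => θV k N ω) - stack (fun k => θF k N ω))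

/-- `ψ̃ = R ψ / ρ(x, s) + (ρ(x, s) - R) / ρ(x, s) · Γ η`. -/
def spiInfluence {p K d : ℕ} (ρ : Vec p → Vec K → ℝ) (Γ : Matrix (Fin p) (Fin K × Fin d) ℝ)
    (ψ : Obs p K → Vec p) (η : Obs p K → StackedVec K d) (w : Obs p K) : Vec p :=
  (w.2.2.2 / ρ w.1 w.2.1) • ψ w
    + ((ρ w.1 w.2.1 - w.2.2.2) / ρ w.1 w.2.1) • matVec Γ (η w)

/-- The variance-covariance matrix of a random vector. -/
def covMatrix {p : ℕ} (μ : Measure Ω) (V : Ω → Vec p) : Matrix (Fin p) (Fin p) ℝ :=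
  Matrix.of fun a b => cov[fun ω => V ω a, fun ω => V ω b; μ]

/-- The entrywise expectation of a random matrix. -/
def matExp {ι κ : Type*} (μ : Measure Ω) (M : Ω → Matrix ι κ ℝ) : Matrix ι κ ℝ :=
  Matrix.of fun a b => ∫ ω, M ω a b ∂μ

/-- The outer product `u vᵀ`. -/
def outer {ι κ : Type*} (u : EuclideanSpace ℝ ι) (v : EuclideanSpace ℝ κ) : Matrix ι κ ℝ :=
  Matrix.vecMulVec u.ofLp v.ofLp

end Sampling

end SPI

end

/-!
Each of the estimators is a zero of an average `Ψ_N(t) = N⁻¹ ∑ g(t; ξᵢ)` of a regular estimating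
function over an i.i.d. sample, so that one theorem about such zeros covers all of them. For the
validation set this needs the observation that `(R / ρ(x, s)) g(t; z)` is again a regular estimating
function, now of the full observation, with the same parameter and the same expected derivative:
since `E (R / ρ ∣ x, s, y) = 1`, reweighting by the bounded density `R / ρ` does not change the law of
`(x, s, y)` (`IsPoissonDesign.map_withDensity_ipWeight`, `IsRegular.smul_weight`). Hence the
influence function on the validation set is `R / ρ` times the one for the full data.

Zeros of `Ψ_N` are asymptotically linear (`IsIIDSample.isInfluenceFunction`). Compactness of the
parameter set, uniqueness of the zero of `E g(t; z)`, and a local uniform law of large numbers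
(`IsIIDSample.exists_ball_average_le`) confine all zeros to a neighbourhood of `t₀` with probability
tending to one. There, the same law of large numbers, applied to the remainder of the derivative of
`g(·; z)` at `t₀` divided by `‖t - t₀‖`, linearises `Ψ_N` uniformly, so that every zero satisfies
`t - t₀ = -A⁻¹ Ψ_N(t₀) + o(‖Ψ_N(t₀)‖)`, where `A = E ∂g(t₀; z)/∂tᵀ`; by Chebyshev's inequality
`√N Ψ_N(t₀)` is bounded in probability. The uniform statements are quantified over uncountably many
parameters; they are phrased with outer probabilities (`HoldsWHP`), which avoids measurability
questions about the sets of zeros.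

Influence functions are compatible with linear maps and sums, which gives that of `β̂`. Asymptotic
normality follows from the multivariate central limit theorem
(`IsIIDSample.tendstoInDistribution_sum`) and Slutsky's theorem, because `n / N → E R = r`
in probability. For the variance, put `W = R / ρ` and write `ψ̃ = W ψ + (1 - W) Γ η`; as `R² = R`,
`W² = W / ρ`, so the products of components of `ψ̃` are affine in `W`, and `W` may be
replaced by its conditional mean one (`IsPoissonDesign.integral_mul_ipWeight_comb`).
-/

noncomputable section

namespace SPI

section IIDSampling

variable {Ω : Type*} [MeasurableSpace Ω] {μ : Measure Ω}

/-! ### Events holding with probability tending to one -/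

/-- `P N` holds with (outer) probability tending to one. No measurability of `P N` is required,
which matters for statements quantified over an uncountable parameter set. -/
def HoldsWHP (μ : Measure Ω) (P : ℕ → Ω → Prop) : Prop :=
  Tendsto (fun N => μ {ω | ¬ P N ω}) atTop (𝓝 0)

lemma HoldsWHP.mono_ae {P Q : ℕ → Ω → Prop} (hP : HoldsWHP μ P)
    (h : ∀ᶠ N in atTop, ∀ᵐ ω ∂μ, P N ω → Q N ω) : HoldsWHP μ Q := by
  refine tendsto_of_tendsto_of_tendsto_of_le_of_le' tendsto_const_nhds hP
    (Eventually.of_forall fun _ => zero_le) ?_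
  filter_upwards [h] with N hN
  refine measure_mono_ae ?_
  filter_upwards [hN] with ω hω hQ using fun hP => hQ (hω hP)

lemma HoldsWHP.mono {P Q : ℕ → Ω → Prop} (hP : HoldsWHP μ P)
    (h : ∀ N ω, P N ω → Q N ω) : HoldsWHP μ Q :=
  hP.mono_ae (Eventually.of_forall fun N => Eventually.of_forall fun ω => h N ω)

lemma HoldsWHP.and {P Q : ℕ → Ω → Prop} (hP : HoldsWHP μ P) (hQ : HoldsWHP μ Q) :
    HoldsWHP μ fun N ω => P N ω ∧ Q N ω := by
  have h := Tendsto.add hP hQ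
  rw [add_zero] at h
  refine tendsto_of_tendsto_of_tendsto_of_le_of_le tendsto_const_nhds h
    (fun _ => zero_le) fun N => ?_
  refine (measure_mono ?_).trans (measure_union_le _ _)
  intro ω hω
  simp only [Set.mem_ofPred_eq, Set.mem_union] at hω ⊢
  tauto

lemma HoldsWHP.of_forall {P : ℕ → Ω → Prop} (h : ∀ N ω, P N ω) : HoldsWHP μ P := by
  simp [HoldsWHP, h]

lemma HoldsWHP.of_tendstoInMeasure {E : Type*} [SeminormedAddCommGroup E] {f : ℕ → Ω → E}
    {g : Ω → E} (h : TendstoInMeasure μ f atTop g) {ε : ℝ} (hε : 0 < ε) :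
    HoldsWHP μ fun N ω => ‖f N ω - g ω‖ < ε := by
  simpa [HoldsWHP] using tendstoInMeasure_iff_norm.1 h ε hε

lemma tendstoInMeasure_add {E : Type*} [SeminormedAddCommGroup E] {f f' : ℕ → Ω → E} {g g' : Ω → E}
    (h : TendstoInMeasure μ f atTop g) (h' : TendstoInMeasure μ f' atTop g') :
    TendstoInMeasure μ (fun N ω => f N ω + f' N ω) atTop (fun ω => g ω + g' ω) := by
  refine tendstoInMeasure_iff_norm.2 fun ε hε => ?_
  have := ((HoldsWHP.of_tendstoInMeasure h (half_pos hε)).and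
    (HoldsWHP.of_tendstoInMeasure h' (half_pos hε))).mono
    (Q := fun N ω => ‖f N ω + f' N ω - (g ω + g' ω)‖ < ε) fun N ω hω => by
      have := norm_add_le (f N ω - g ω) (f' N ω - g' ω)
      rw [add_sub_add_comm]
      linarith [hω.1, hω.2]
  simpa [HoldsWHP] using this

lemma tendstoInMeasure_clm_apply {E F : Type*} [NormedAddCommGroup E] [NormedSpace ℝ E]
    [NormedAddCommGroup F] [NormedSpace ℝ F] (L : E →L[ℝ] F) {f : ℕ → Ω → E}
    (h : TendstoInMeasure μ f atTop fun _ => 0) :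
    TendstoInMeasure μ (fun N ω => L (f N ω)) atTop fun _ => 0 := by
  refine tendstoInMeasure_iff_norm.2 fun ε hε => ?_
  have hc : 0 < ‖L‖ + 1 := by positivity
  have := (HoldsWHP.of_tendstoInMeasure h (div_pos hε hc)).mono
    (Q := fun N ω => ‖L (f N ω) - 0‖ < ε) fun N ω hω => by
      rw [sub_zero] at hω ⊢
      rw [lt_div_iff₀ hc] at hω
      have := L.le_opNorm (f N ω)
      nlinarith [norm_nonneg (f N ω)]
  simpa [HoldsWHP] using this

/-! ### Independent samples -/

/-- If the functions `q t`, `t ∈ S`, have an integrable envelope and `q t z → 0` as `t → a`, then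
their supremum over a small ball around `a` has small integral. The supremum is taken over a
countable dense subset of the ball, which makes it measurable. -/
lemma exists_ball_integral_sup_lt {Z : Type*} [MeasurableSpace Z] {ν : Measure Z} {T : Type*}
    [PseudoMetricSpace T] [SecondCountableTopology T] {S : Set T} {a : T} {q : T → Z → ℝ}
    {F : Z → ℝ}
    (hmeas : ∀ t ∈ S, AEMeasurable (q t) ν)
    (hcont : ∀ᵐ z ∂ν, ContinuousOn (fun t => q t z) S)
    (hF : Integrable F ν) (hbound : ∀ᵐ z ∂ν, ∀ t ∈ S, q t z ≤ F z)
    (hnonneg : ∀ᵐ z ∂ν, ∀ t ∈ S, 0 ≤ q t z)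
    (hlim : ∀ᵐ z ∂ν, Tendsto (fun t => q t z) (𝓝[S] a) (𝓝 0)) {ε : ℝ} (hε : 0 < ε) :
    ∃ δ > 0, ∃ Q : Z → ℝ, Integrable Q ν ∧ ∫ z, Q z ∂ν < ε ∧
      ∀ᵐ z ∂ν, ∀ t ∈ S, dist t a < δ → q t z ≤ Q z := by
  have hsep : ∀ n : ℕ, ∃ D ⊆ S ∩ Metric.ball a (1 / ((n : ℝ) + 1)), D.Countable ∧
      S ∩ Metric.ball a (1 / ((n : ℝ) + 1)) ⊆ closure D := fun n =>
    (TopologicalSpace.IsSeparable.of_separableSpace _).exists_countable_dense_subset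
  choose D hDS hDc hDd using hsep
  obtain ⟨Q, hQ⟩ : ∃ Q : ℕ → Z → ℝ, ∀ n z, Q n z = ⨆ t : D n, q t z := ⟨_, fun _ _ => rfl⟩
  have hQmeas : ∀ n, AEMeasurable (Q n) ν := fun n => by
    have := (hDc n).to_subtype
    rw [funext (hQ n)]
    exact AEMeasurable.iSup fun t => hmeas t (hDS n t.2).1
  have hQnonneg : ∀ n z, (∀ t ∈ S, 0 ≤ q t z) → 0 ≤ Q n z := fun n z hz => by
    rw [hQ]
    exact Real.iSup_nonneg fun t : D n => hz t (hDS n t.2).1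
  have hQle : ∀ n z (c : ℝ), 0 ≤ c → (∀ t ∈ D n, q t z ≤ c) → Q n z ≤ c := fun n z c hc hz => by
    rw [hQ]
    exact Real.iSup_le (fun t : D n => hz t t.2) hc
  have hQbound : ∀ n, ∀ᵐ z ∂ν, ‖Q n z‖ ≤ |F z| := fun n => by
    filter_upwards [hbound, hnonneg] with z hz hz0
    rw [Real.norm_eq_abs, abs_of_nonneg (hQnonneg n z hz0)]
    exact hQle n z _ (abs_nonneg _) fun t ht => (hz t (hDS n ht).1).trans (le_abs_self _)
  have hQlim : ∀ᵐ z ∂ν, Tendsto (fun n => Q n z) atTop (𝓝 0) := by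
    filter_upwards [hlim, hnonneg] with z hz hz0
    rw [Metric.tendsto_atTop]
    intro κ hκ
    have hev := (tendsto_order.1 hz).2 (κ / 2) (half_pos hκ)
    obtain ⟨r, hr, hrS⟩ := Metric.mem_nhdsWithin_iff.1 hev
    obtain ⟨n₀, hn₀⟩ := exists_nat_one_div_lt hr
    refine ⟨n₀, fun n hn => ?_⟩
    rw [Real.dist_eq, sub_zero, abs_of_nonneg (hQnonneg n z hz0)]
    refine lt_of_le_of_lt (hQle n z _ (half_pos hκ).le fun t htD => ?_) (half_lt_self hκ)
    have ht := hDS n htD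
    have hn' : (n₀ : ℝ) + 1 ≤ n + 1 := by exact_mod_cast Nat.succ_le_succ hn
    have hlt : dist t a < r := lt_of_lt_of_le ht.2
      ((one_div_le_one_div_of_le (by positivity) hn').trans hn₀.le)
    exact le_of_lt (hrS ⟨hlt, ht.1⟩)
  have htend := tendsto_integral_of_dominated_convergence (fun z => |F z|)
    (fun n => (hQmeas n).aestronglyMeasurable) hF.abs hQbound hQlim
  rw [integral_zero] at htend
  obtain ⟨n, hn⟩ := ((tendsto_order.1 htend).2 ε hε).exists
  refine ⟨1 / ((n : ℝ) + 1), by positivity, Q n,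
    hF.abs.mono' (hQmeas n).aestronglyMeasurable (hQbound n), hn, ?_⟩
  filter_upwards [hcont, hbound] with z hz hzF t ht hta
  have hbdd : BddAbove (Set.range fun t : D n => q t z) :=
    ⟨F z, by rintro _ ⟨t, rfl⟩; exact hzF t (hDS n t.2).1⟩
  have hcw : ContinuousWithinAt (fun t => q t z) (D n) t :=
    (hz t ht).mono fun s hs => (hDS n hs).1
  have hmaps : Set.MapsTo (fun t => q t z) (D n) (Set.Iic (Q n z)) := fun s hs => by
    rw [Set.mem_Iic, hQ]
    exact le_ciSup hbdd (⟨s, hs⟩ : D n)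
  have := hcw.mem_closure (hDd n ⟨ht, hta⟩) hmaps
  rwa [isClosed_Iic.closure_eq] at this

/-- `ξ 0, ξ 1, …` is an i.i.d. sample from the law `ν`. -/
structure IsIIDSample {Z : Type*} [MeasurableSpace Z] (μ : Measure Ω) (ξ : ℕ → Ω → Z)
    (ν : Measure Z) : Prop where
  measurable : ∀ i, Measurable (ξ i)
  indep : iIndepFun ξ μ
  law : ∀ i, μ.map (ξ i) = ν

namespace IsIIDSample

variable {Z : Type*} [MeasurableSpace Z] {ξ : ℕ → Ω → Z} {ν : Measure Z}

lemma comp (h : IsIIDSample μ ξ ν) {Z' : Type*} [MeasurableSpace Z'] {z : Z → Z'}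
    (hz : Measurable z) : IsIIDSample μ (fun i ω => z (ξ i ω)) (ν.map z) where
  measurable i := hz.comp (h.measurable i)
  indep := h.indep.comp (fun _ => z) fun _ => hz
  law i := by
    rw [← h.law i, Measure.map_map hz (h.measurable i)]
    rfl

lemma quasiMeasurePreserving (h : IsIIDSample μ ξ ν) (i : ℕ) :
    Measure.QuasiMeasurePreserving (ξ i) μ ν :=
  ⟨h.measurable i, by rw [h.law i]⟩

lemma ae_forall (h : IsIIDSample μ ξ ν) {P : Z → Prop} (hP : ∀ᵐ z ∂ν, P z) :
    ∀ᵐ ω ∂μ, ∀ i, P (ξ i ω) :=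
  ae_all_iff.2 fun i => (h.quasiMeasurePreserving i).ae hP

lemma identDistrib (h : IsIIDSample μ ξ ν) (i : ℕ) : IdentDistrib (ξ i) (ξ 0) μ μ :=
  ⟨(h.measurable i).aemeasurable, (h.measurable 0).aemeasurable, by rw [h.law, h.law]⟩

lemma iIndepFun_comp (h : IsIIDSample μ ξ ν) {E : Type*} [MeasurableSpace E] {f : Z → E}
    (hf : AEMeasurable f ν) : iIndepFun (fun i ω => f (ξ i ω)) μ :=
  h.indep.comp₀ (fun _ => f) (fun i => (h.measurable i).aemeasurable)
    fun i => by rwa [h.law i]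

lemma identDistrib_comp (h : IsIIDSample μ ξ ν) {E : Type*} [MeasurableSpace E] {f : Z → E}
    (hf : AEMeasurable f ν) (i : ℕ) :
    IdentDistrib (fun ω => f (ξ i ω)) (fun ω => f (ξ 0 ω)) μ μ :=
  (h.identDistrib i).comp_of_aemeasurable (by rwa [h.law i])

lemma integral_comp (h : IsIIDSample μ ξ ν) {E : Type*} [NormedAddCommGroup E] [NormedSpace ℝ E]
    {f : Z → E} (hf : AEStronglyMeasurable f ν) (i : ℕ) :
    ∫ ω, f (ξ i ω) ∂μ = ∫ z, f z ∂ν := by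
  rw [← h.law i, integral_map (h.measurable i).aemeasurable (by rwa [h.law i])]

lemma integrable_comp (h : IsIIDSample μ ξ ν) {E : Type*} [NormedAddCommGroup E]
    {f : Z → E} (hf : Integrable f ν) (i : ℕ) : Integrable (fun ω => f (ξ i ω)) μ := by
  rw [← h.law i] at hf
  exact hf.comp_measurable (h.measurable i)

lemma memLp_comp (h : IsIIDSample μ ξ ν) {E : Type*} [NormedAddCommGroup E]
    {f : Z → E} (hf : MemLp f 2 ν) (i : ℕ) : MemLp (fun ω => f (ξ i ω)) 2 μ := by
  rw [← h.law i] at hf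
  exact hf.comp_of_map (h.measurable i).aemeasurable

variable [IsProbabilityMeasure μ]

lemma isProbabilityMeasure (h : IsIIDSample μ ξ ν) : IsProbabilityMeasure ν := by
  rw [← h.law 0]
  exact Measure.isProbabilityMeasure_map (h.measurable 0).aemeasurable

/-- The weak law of large numbers. -/
lemma tendstoInMeasure_average (h : IsIIDSample μ ξ ν) {E : Type*} [NormedAddCommGroup E]
    [NormedSpace ℝ E] [CompleteSpace E] {f : Z → E} (hf : Integrable f ν) :
    TendstoInMeasure μ (fun (N : ℕ) ω => (1 / (N : ℝ)) • ∑ i ∈ Finset.range N, f (ξ i ω)) atTop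
      fun _ => ∫ z, f z ∂ν := by
  borelize E
  have hslln := strong_law_ae (fun i ω => f (ξ i ω)) (h.integrable_comp hf 0)
    (fun i j hij => (h.iIndepFun_comp hf.aemeasurable).indepFun hij)
    (h.identDistrib_comp hf.aemeasurable)
  rw [h.integral_comp hf.aestronglyMeasurable 0] at hslln
  refine tendstoInMeasure_of_tendsto_ae (fun N => ?_) (by simpa using hslln)
  refine AEStronglyMeasurable.const_smul ?_ _
  exact Finset.aestronglyMeasurable_fun_sum _ fun i _ =>
    (h.integrable_comp hf i).aestronglyMeasurable

/-- A local uniform law of large numbers: if the functions `q t`, `t ∈ S`, have an integrable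
envelope and `q t z → 0` as `t → a`, then averages of `q t` are uniformly small for `t` near `a`. -/
lemma exists_ball_average_le (h : IsIIDSample μ ξ ν) {T : Type*} [PseudoMetricSpace T]
    [SecondCountableTopology T] {S : Set T} {a : T} {q : T → Z → ℝ} {F : Z → ℝ}
    (hmeas : ∀ t ∈ S, AEMeasurable (q t) ν)
    (hcont : ∀ᵐ z ∂ν, ContinuousOn (fun t => q t z) S)
    (hF : Integrable F ν) (hbound : ∀ᵐ z ∂ν, ∀ t ∈ S, q t z ≤ F z)
    (hnonneg : ∀ᵐ z ∂ν, ∀ t ∈ S, 0 ≤ q t z)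
    (hlim : ∀ᵐ z ∂ν, Tendsto (fun t => q t z) (𝓝[S] a) (𝓝 0)) {ε : ℝ} (hε : 0 < ε) :
    ∃ δ > 0, HoldsWHP μ fun N ω => ∀ t ∈ S, dist t a < δ →
      (1 / (N : ℝ)) * ∑ i ∈ Finset.range N, q t (ξ i ω) ≤ ε := by
  obtain ⟨δ, hδ, Q, hQ, hQε, hsup⟩ :=
    exists_ball_integral_sup_lt hmeas hcont hF hbound hnonneg hlim (half_pos hε)
  have havg := h.tendstoInMeasure_average hQ
  have hlln : HoldsWHP μ fun N ω =>
      ‖(1 / (N : ℝ)) • ∑ i ∈ Finset.range N, Q (ξ i ω) - ∫ z, Q z ∂ν‖ < ε / 2 :=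
    HoldsWHP.of_tendstoInMeasure havg (half_pos hε)
  refine ⟨δ, hδ, hlln.mono_ae (Eventually.of_forall fun N => ?_)⟩
  filter_upwards [h.ae_forall hsup] with ω hω hN t ht hta
  have h1 : (1 / (N : ℝ)) * ∑ i ∈ Finset.range N, q t (ξ i ω)
      ≤ (1 / (N : ℝ)) * ∑ i ∈ Finset.range N, Q (ξ i ω) :=
    mul_le_mul_of_nonneg_left (Finset.sum_le_sum fun i _ => hω i t ht hta) (by positivity)
  rw [Real.norm_eq_abs, smul_eq_mul] at hN
  linarith [(abs_lt.1 hN).2]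

/-- The second moment of a normalised sum of centred i.i.d. vectors does not depend on the number of
summands, so by Chebyshev's inequality normalised sums are bounded in probability. -/
lemma measure_norm_sum_ge_le (h : IsIIDSample μ ξ ν) {e : ℕ} {f : Z → Vec e} (hf : MemLp f 2 ν)
    (hf0 : ∫ z, f z ∂ν = 0) {M : ℝ} (hM : 0 < M) {N : ℕ} (hN : 0 < N) :
    μ {ω | M ≤ ‖(√(N : ℝ))⁻¹ • ∑ i ∈ Finset.range N, f (ξ i ω)‖}
      ≤ ENNReal.ofReal ((∑ j, ∫ z, (f z j) ^ 2 ∂ν) / M ^ 2) := by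
  have := h.isProbabilityMeasure
  have hfj : ∀ j, MemLp (fun z => f z j) 2 ν := fun j =>
    (EuclideanSpace.proj (𝕜 := ℝ) j).comp_memLp' hf
  have hmean : ∀ j, ∫ z, f z j ∂ν = 0 := fun j => by
    have := (EuclideanSpace.proj (𝕜 := ℝ) j).integral_comp_comm (hf.integrable (by norm_num))
    simpa [hf0] using this
  have hLp : ∀ j i, MemLp (fun ω => f (ξ i ω) j) 2 μ := fun j i => h.memLp_comp (hfj j) i
  have hLpS : ∀ j, MemLp (fun ω => ∑ i ∈ Finset.range N, f (ξ i ω) j) 2 μ := fun j =>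
    memLp_finsetSum _ fun i _ => hLp j i
  have hvar : ∀ j, ∫ ω, (∑ i ∈ Finset.range N, f (ξ i ω) j) ^ 2 ∂μ
      = N * ∫ z, (f z j) ^ 2 ∂ν := fun j => by
    have hE : ∫ ω, ∑ i ∈ Finset.range N, f (ξ i ω) j ∂μ = 0 := by
      rw [integral_finsetSum _ fun i _ => (hLp j i).integrable (by norm_num)]
      exact Finset.sum_eq_zero fun i _ => by
        rw [h.integral_comp (f := fun z => f z j) (hfj j).aestronglyMeasurable i, hmean j]
    have hv := IndepFun.variance_sum (X := fun i ω => f (ξ i ω) j) (s := Finset.range N) (μ := μ)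
      (fun i _ => hLp j i) fun i _ k _ hik =>
        (h.iIndepFun_comp (f := fun z => f z j) (hfj j).aestronglyMeasurable.aemeasurable).indepFun
          hik
    have hs : (∑ i ∈ Finset.range N, fun ω => f (ξ i ω) j)
        = fun ω => ∑ i ∈ Finset.range N, f (ξ i ω) j := by ext; simp
    rw [hs, variance_of_integral_eq_zero (hLpS j).aestronglyMeasurable.aemeasurable hE] at hv
    rw [hv, Finset.sum_congr rfl fun i _ => ?_, Finset.sum_const, Finset.card_range, nsmul_eq_mul]
    rw [variance_of_integral_eq_zero (hLp j i).aestronglyMeasurable.aemeasurable (by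
      rw [h.integral_comp (f := fun z => f z j) (hfj j).aestronglyMeasurable i, hmean j])]
    exact h.integral_comp (f := fun z => (f z j) ^ 2) ((hfj j).aestronglyMeasurable.pow 2) i
  have hNpos : (0 : ℝ) < N := by exact_mod_cast hN
  have hnorm : ∀ ω, ‖(√(N : ℝ))⁻¹ • ∑ i ∈ Finset.range N, f (ξ i ω)‖ ^ 2
      = (N : ℝ)⁻¹ * ∑ j, (∑ i ∈ Finset.range N, f (ξ i ω) j) ^ 2 := fun ω => by
    rw [norm_smul, mul_pow, EuclideanSpace.norm_sq_eq, Real.norm_eq_abs, sq_abs, inv_pow,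
      Real.sq_sqrt hNpos.le]
    simp
  have hint : Integrable
      (fun ω => ‖(√(N : ℝ))⁻¹ • ∑ i ∈ Finset.range N, f (ξ i ω)‖ ^ 2) μ := by
    simp_rw [hnorm]
    exact (integrable_finsetSum _ fun j _ => (hLpS j).integrable_sq).const_mul _
  have hval : ∫ ω, ‖(√(N : ℝ))⁻¹ • ∑ i ∈ Finset.range N, f (ξ i ω)‖ ^ 2 ∂μ
      = ∑ j, ∫ z, (f z j) ^ 2 ∂ν := by
    simp_rw [hnorm]
    rw [integral_const_mul, integral_finsetSum _ fun j _ => (hLpS j).integrable_sq]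
    simp_rw [hvar]
    rw [← Finset.mul_sum, ← mul_assoc, inv_mul_cancel₀ hNpos.ne', one_mul]
  have hmarkov := mul_meas_ge_le_integral_of_nonneg
    (Eventually.of_forall fun ω => sq_nonneg ‖(√(N : ℝ))⁻¹ • ∑ i ∈ Finset.range N, f (ξ i ω)‖)
    hint (M ^ 2)
  rw [hval] at hmarkov
  rw [← ofReal_measureReal]
  refine ENNReal.ofReal_le_ofReal ?_
  rw [le_div_iff₀ (by positivity), mul_comm]
  refine le_trans (le_of_eq ?_) hmarkov
  congr 3
  ext ω
  exact (sq_le_sq₀ hM.le (norm_nonneg _)).symm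

end IsIIDSample

end IIDSampling

section ZEstimation

variable {Ω : Type*} [MeasurableSpace Ω] {μ : Measure Ω}
  {Z : Type*} [MeasurableSpace Z] {ξ : ℕ → Ω → Z} {ν : Measure Z}

/-! ### Zeros of averaged estimating functions -/

namespace IsRegular

variable {e : ℕ} {g : Vec e → Z → Vec e} {B : Set (Vec e)} {t₀ : Vec e}

lemma integrable (hg : IsRegular ν g B t₀) {t : Vec e} (ht : t ∈ B) : Integrable (g t) ν := by
  obtain ⟨F, hF, hgF⟩ := hg.envelope
  refine hF.mono' (hg.measurable t).aestronglyMeasurable ?_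
  filter_upwards [hgF] with z hz using hz t ht

lemma mem (hg : IsRegular ν g B t₀) : t₀ ∈ B := interior_subset hg.mem_interior

/-- The derivative of the estimating function at the true value is measurable, as a limit of
difference quotients. -/
lemma aestronglyMeasurable_fderiv (hg : IsRegular ν g B t₀) :
    AEStronglyMeasurable (fun z => fderiv ℝ (fun t => g t z) t₀) ν := by
  obtain ⟨U, hU, htU, hC, -⟩ := hg.smooth
  have hdir : ∀ v, AEMeasurable (fun z => fderiv ℝ (fun t => g t z) t₀ v) ν := fun v => by
    refine aemeasurable_of_tendsto_metrizable_ae atTop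
      (f := fun (n : ℕ) z => ((n : ℝ) + 1) • (g (t₀ + ((n : ℝ) + 1)⁻¹ • v) z - g t₀ z))
      (fun n => (((hg.measurable _).sub (hg.measurable _)).const_smul ((n : ℝ) + 1)).aemeasurable)
      ?_
    filter_upwards [hC] with z hz
    have hd : DifferentiableAt ℝ (fun t => g t z) t₀ :=
      (hz.contDiffAt (hU.mem_nhds htU)).differentiableAt (by norm_num)
    have hlim : Tendsto (fun n : ℕ => (n : ℝ) + 1) atTop atTop :=
      tendsto_atTop_add_const_right _ _ tendsto_natCast_atTop_atTop
    exact hd.hasFDerivAt.lim v (tendsto_norm_atTop_atTop.comp hlim)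
  have hsum : (fun z => fderiv ℝ (fun t => g t z) t₀) = fun z => ∑ i : Fin e,
      (ContinuousLinearMap.smulRightL ℝ (Vec e) (Vec e) (EuclideanSpace.proj i))
        (fderiv ℝ (fun t => g t z) t₀ (EuclideanSpace.single i 1)) := by
    ext1 z
    refine ContinuousLinearMap.ext fun v => ?_
    have hv : v = ∑ i, v i • EuclideanSpace.single i (1 : ℝ) := by
      simpa using ((EuclideanSpace.basisFun (Fin e) ℝ).sum_repr v).symm
    conv_lhs => rw [hv]
    simp
  rw [hsum]
  refine Finset.aestronglyMeasurable_fun_sum _ fun i _ => ?_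
  exact (ContinuousLinearMap.continuous _).comp_aestronglyMeasurable (hdir _).aestronglyMeasurable

lemma integrable_fderiv (hg : IsRegular ν g B t₀) :
    Integrable (fun z => fderiv ℝ (fun t => g t z) t₀) ν := by
  obtain ⟨U, -, htU, -, G, hG, hbound⟩ := hg.smooth
  refine hG.mono' hg.aestronglyMeasurable_fderiv ?_
  filter_upwards [hbound] with z hz using hz t₀ htU

lemma memLp_fullInfluence (hg : IsRegular ν g B t₀) : MemLp (fullInfluence ν g t₀) 2 ν :=
  ((∫ z, fderiv ℝ (fun t => g t z) t₀ ∂ν).inverse.comp_memLp' hg.square_integrable).neg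

end IsRegular

namespace IsIIDSample

variable {e : ℕ} {g : Vec e → Z → Vec e} {B : Set (Vec e)} {t₀ : Vec e} [IsProbabilityMeasure μ]

/-- Consistency, in the form that all zeros of the averaged estimating function in the parameter set
are close to the true value. By compactness it suffices to exclude zeros near any other point, where
the average is close to its non-zero expectation. -/
lemma zeros_mem_nhds (h : IsIIDSample μ ξ ν) (hg : IsRegular ν g B t₀) {V : Set (Vec e)}
    (hV : IsOpen V) (htV : t₀ ∈ V) :
    HoldsWHP μ fun N ω => ∀ t ∈ B,
      (1 / (N : ℝ)) • ∑ i ∈ Finset.range N, g t (ξ i ω) = 0 → t ∈ V := by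
  have key : HoldsWHP μ fun N ω => ∀ t ∈ B \ V,
      (1 / (N : ℝ)) • ∑ i ∈ Finset.range N, g t (ξ i ω) ≠ 0 := by
    refine (hg.isCompact.diff hV).induction_on (p := fun s => HoldsWHP μ fun N ω => ∀ t ∈ s,
      (1 / (N : ℝ)) • ∑ i ∈ Finset.range N, g t (ξ i ω) ≠ 0) ?_ ?_ ?_ ?_
    · exact HoldsWHP.of_forall fun N ω t ht => ht.elim
    · exact fun s s' hs hs' => hs'.mono fun N ω hω t ht => hω t (hs ht)
    · exact fun s s' hs hs' => (hs.and hs').mono fun N ω hω t ht => ht.elim (hω.1 t) (hω.2 t)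
    · intro a ha
      have hc : 0 < ‖∫ z, g a z ∂ν‖ := norm_pos_iff.2 fun h0 =>
        ha.2 (hg.identification a ha.1 h0 ▸ htV)
      obtain ⟨F, hF, hgF⟩ := hg.envelope
      obtain ⟨δ, hδ, hδN⟩ := h.exists_ball_average_le (S := B) (a := a)
        (q := fun t z => ‖g t z - g a z‖) (F := fun z => F z + F z)
        (fun t _ => ((hg.measurable t).sub (hg.measurable a)).norm.aemeasurable)
        (by filter_upwards [hg.continuousOn] with z hz using (hz.sub continuousOn_const).norm)
        (hF.add hF)
        (by
          filter_upwards [hgF] with z hz t ht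
          exact (norm_sub_le _ _).trans (add_le_add (hz t ht) (hz a ha.1)))
        (Eventually.of_forall fun z t _ => norm_nonneg _)
        (by
          filter_upwards [hg.continuousOn] with z hz
          have := ((hz.sub (continuousOn_const (c := g a z))).norm) a ha.1
          simpa [ContinuousWithinAt] using this)
        (ε := ‖∫ z, g a z ∂ν‖ / 3) (by positivity)
      have havg := h.tendstoInMeasure_average (hg.integrable ha.1)
      have hlln : HoldsWHP μ fun N ω =>
          ‖(1 / (N : ℝ)) • ∑ i ∈ Finset.range N, g a (ξ i ω) - ∫ z, g a z ∂ν‖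
            < ‖∫ z, g a z ∂ν‖ / 3 :=
        HoldsWHP.of_tendstoInMeasure havg (by positivity)
      refine ⟨(B \ V) ∩ Metric.ball a δ,
        inter_mem self_mem_nhdsWithin (mem_nhdsWithin_of_mem_nhds (Metric.ball_mem_nhds a hδ)),
        (hδN.and hlln).mono ?_⟩
      rintro N ω ⟨h1, h2⟩ t ht h0
      have h3 := h1 t ht.1.1 ht.2
      have h4 : ‖(1 / (N : ℝ)) • ∑ i ∈ Finset.range N, g a (ξ i ω)‖
          ≤ 1 / (N : ℝ) * ∑ i ∈ Finset.range N, ‖g t (ξ i ω) - g a (ξ i ω)‖ := by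
        have : (1 / (N : ℝ)) • ∑ i ∈ Finset.range N, g a (ξ i ω)
            = -((1 / (N : ℝ)) • ∑ i ∈ Finset.range N, (g t (ξ i ω) - g a (ξ i ω))) := by
          rw [Finset.sum_sub_distrib, smul_sub, h0, zero_sub, neg_neg]
        rw [this, norm_neg, norm_smul, Real.norm_of_nonneg (by positivity)]
        exact mul_le_mul_of_nonneg_left (norm_sum_le _ _) (by positivity)
      have h5 := norm_sub_norm_le (∫ z, g a z ∂ν)
        ((1 / (N : ℝ)) • ∑ i ∈ Finset.range N, g a (ξ i ω))
      rw [norm_sub_rev] at h5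
      linarith
  refine key.mono fun N ω hω t ht h0 => ?_
  by_contra htV'
  exact hω t ⟨ht, htV'⟩ h0

/-- Near the true value the averaged estimating function is uniformly close to its linearisation
with the expected derivative. -/
lemma linearization (h : IsIIDSample μ ξ ν) (hg : IsRegular ν g B t₀) {κ : ℝ} (hκ : 0 < κ) :
    ∃ δ > 0, HoldsWHP μ fun N ω => ∀ t, dist t t₀ < δ →
      ‖(1 / (N : ℝ)) • ∑ i ∈ Finset.range N, g t (ξ i ω)
        - (1 / (N : ℝ)) • ∑ i ∈ Finset.range N, g t₀ (ξ i ω)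
        - (∫ z, fderiv ℝ (fun t => g t z) t₀ ∂ν) (t - t₀)‖ ≤ κ * ‖t - t₀‖ := by
  obtain ⟨U, hU, htU, hC, G, hG, hbound⟩ := hg.smooth
  obtain ⟨r, hr, hrU⟩ := Metric.isOpen_iff.1 hU t₀ htU
  have hdiff : ∀ᵐ z ∂ν, ∀ t ∈ U, DifferentiableAt ℝ (fun t => g t z) t := by
    filter_upwards [hC] with z hz t ht
    exact (hz.contDiffAt (hU.mem_nhds ht)).differentiableAt (by norm_num)
  obtain ⟨δ, hδ, hδN⟩ := h.exists_ball_average_le (S := Metric.ball t₀ r \ {t₀}) (a := t₀)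
    (q := fun t z => ‖t - t₀‖⁻¹ * ‖g t z - g t₀ z - fderiv ℝ (fun t => g t z) t₀ (t - t₀)‖)
    (F := fun z => G z + G z)
    (fun t _ => by
      have h1 : AEStronglyMeasurable (fun z => fderiv ℝ (fun t => g t z) t₀ (t - t₀)) ν :=
        (ContinuousLinearMap.apply ℝ (Vec e) (t - t₀)).continuous.comp_aestronglyMeasurable
          hg.aestronglyMeasurable_fderiv
      exact ((((hg.measurable t).sub (hg.measurable t₀)).aestronglyMeasurable.sub
        h1).norm.const_mul _).aemeasurable)
    (by
      filter_upwards [hdiff] with z hz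
      have h1 : ContinuousOn (fun t => g t z) (Metric.ball t₀ r \ {t₀}) := fun t ht =>
        (hz t (hrU ht.1)).continuousAt.continuousWithinAt
      refine (ContinuousOn.inv₀ (by fun_prop) fun t ht => ?_).mul (ContinuousOn.norm ?_)
      · exact norm_ne_zero_iff.2 (sub_ne_zero.2 ht.2)
      · exact (h1.sub continuousOn_const).sub (by fun_prop))
    (hG.add hG)
    (by
      filter_upwards [hdiff, hbound] with z hz hzG t ht
      have hpos : 0 < ‖t - t₀‖ := norm_pos_iff.2 (sub_ne_zero.2 ht.2)
      rw [inv_mul_le_iff₀ hpos]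
      have h1 := (convex_ball t₀ r).norm_image_sub_le_of_norm_fderiv_le (f := fun t => g t z)
        (fun x hx => hz x (hrU hx)) (fun x hx => hzG x (hrU hx)) (Metric.mem_ball_self hr) ht.1
      have h2 := (fderiv ℝ (fun t => g t z) t₀).le_of_opNorm_le (hzG t₀ htU) (t - t₀)
      refine (norm_sub_le _ _).trans ?_
      linarith)
    (Eventually.of_forall fun z t _ => by positivity)
    (by
      filter_upwards [hdiff] with z hz
      exact (hasFDerivAt_iff_tendsto.1 (hz t₀ htU).hasFDerivAt).mono_left nhdsWithin_le_nhds)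
    (half_pos hκ)
  have havg := h.tendstoInMeasure_average hg.integrable_fderiv
  have hlln : HoldsWHP μ fun N ω =>
      ‖(1 / (N : ℝ)) • ∑ i ∈ Finset.range N, fderiv ℝ (fun t => g t (ξ i ω)) t₀
        - ∫ z, fderiv ℝ (fun t => g t z) t₀ ∂ν‖ < κ / 2 :=
    HoldsWHP.of_tendstoInMeasure havg (half_pos hκ)
  refine ⟨min δ r, lt_min hδ hr, (hδN.and hlln).mono ?_⟩
  rintro N ω ⟨h1, h2⟩ t ht
  rcases eq_or_ne t t₀ with rfl | hne
  · simp
  have hpos : 0 < ‖t - t₀‖ := norm_pos_iff.2 (sub_ne_zero.2 hne)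
  have h3 := h1 t ⟨ht.trans_le (min_le_right _ _), hne⟩ (ht.trans_le (min_le_left _ _))
  rw [← Finset.mul_sum, mul_left_comm, inv_mul_le_iff₀ hpos] at h3
  have h4 := ContinuousLinearMap.le_of_opNorm_le _ h2.le (t - t₀)
  have h5 : ‖(1 / (N : ℝ)) • ∑ i ∈ Finset.range N,
      (g t (ξ i ω) - g t₀ (ξ i ω) - fderiv ℝ (fun t => g t (ξ i ω)) t₀ (t - t₀))‖
      ≤ ‖t - t₀‖ * (κ / 2) := by
    rw [norm_smul, Real.norm_of_nonneg (by positivity)]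
    exact (mul_le_mul_of_nonneg_left (norm_sum_le _ _) (by positivity)).trans h3
  have h6 : (1 / (N : ℝ)) • ∑ i ∈ Finset.range N, g t (ξ i ω)
        - (1 / (N : ℝ)) • ∑ i ∈ Finset.range N, g t₀ (ξ i ω)
        - (∫ z, fderiv ℝ (fun t => g t z) t₀ ∂ν) (t - t₀)
      = (1 / (N : ℝ)) • ∑ i ∈ Finset.range N,
          (g t (ξ i ω) - g t₀ (ξ i ω) - fderiv ℝ (fun t => g t (ξ i ω)) t₀ (t - t₀))
        + ((1 / (N : ℝ)) • ∑ i ∈ Finset.range N, fderiv ℝ (fun t => g t (ξ i ω)) t₀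
          - ∫ z, fderiv ℝ (fun t => g t z) t₀ ∂ν) (t - t₀) := by
    simp only [Finset.sum_sub_distrib, smul_sub, _root_.sub_apply,
      _root_.smul_apply, _root_.sum_apply]
    abel
  rw [h6]
  refine (norm_add_le _ _).trans ?_
  linarith

/-- Every zero `t` of the averaged estimating function satisfies
`t - t₀ = -A⁻¹ Ψ_N(t₀) + o(‖Ψ_N(t₀)‖)`, where `A` is the expected derivative. -/
lemma zeros_expansion (h : IsIIDSample μ ξ ν) (hg : IsRegular ν g B t₀) {κ : ℝ} (hκ : 0 < κ) :
    HoldsWHP μ fun N ω => ∀ t ∈ B, (1 / (N : ℝ)) • ∑ i ∈ Finset.range N, g t (ξ i ω) = 0 →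
      ‖t - t₀ + (∫ z, fderiv ℝ (fun t => g t z) t₀ ∂ν).inverse
          ((1 / (N : ℝ)) • ∑ i ∈ Finset.range N, g t₀ (ξ i ω))‖
        ≤ κ * ‖(1 / (N : ℝ)) • ∑ i ∈ Finset.range N, g t₀ (ξ i ω)‖ := by
  set A := ∫ z, fderiv ℝ (fun t => g t z) t₀ ∂ν with hA
  have hc : 0 < ‖A.inverse‖ + 1 := by positivity
  obtain ⟨c, hcdef⟩ : ∃ c, c = ‖A.inverse‖ + 1 := ⟨_, rfl⟩
  rw [← hcdef] at hc
  -- the linearisation error `τ ‖x‖` has to be absorbed twice, in `‖x‖ ≤ 2 c ‖y‖` and in the claim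
  obtain ⟨τ, hτ, hτ1, hτ2⟩ : ∃ τ > 0, c * τ ≤ 1 / 2 ∧ c * τ * (2 * c) ≤ κ := by
    refine ⟨min (1 / (2 * c)) (κ / (2 * c ^ 2)), by positivity, ?_, ?_⟩
    · refine (mul_le_mul_of_nonneg_left (min_le_left _ _) hc.le).trans (le_of_eq ?_)
      field_simp
    · have := mul_le_mul_of_nonneg_left (min_le_right (1 / (2 * c)) (κ / (2 * c ^ 2))) hc.le
      refine (mul_le_mul_of_nonneg_right this (by positivity)).trans (le_of_eq ?_)
      field_simp
  obtain ⟨δ, hδ, hlin⟩ := h.linearization hg hτ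
  refine (hlin.and (h.zeros_mem_nhds hg Metric.isOpen_ball (Metric.mem_ball_self hδ))).mono ?_
  rintro N ω ⟨h1, h2⟩ t ht h0
  have h3 := h1 t (h2 t ht h0)
  rw [h0, zero_sub] at h3
  set y := (1 / (N : ℝ)) • ∑ i ∈ Finset.range N, g t₀ (ξ i ω)
  have h4 : t - t₀ + A.inverse y = A.inverse (A (t - t₀) + y) := by
    rw [map_add, hg.jacobian_invertible.inverse_apply_self]
  have hL : ∀ v, ‖A.inverse v‖ ≤ c * ‖v‖ := fun v =>
    A.inverse.le_of_opNorm_le (by rw [hcdef]; linarith) v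
  have h5 : ‖t - t₀ + A.inverse y‖ ≤ c * τ * ‖t - t₀‖ := by
    rw [h4, mul_assoc]
    refine (hL _).trans (mul_le_mul_of_nonneg_left ?_ hc.le)
    rw [← norm_neg, neg_add', sub_eq_add_neg, add_comm, ← sub_eq_add_neg]
    exact h3
  have h6 : ‖t - t₀‖ ≤ ‖t - t₀ + A.inverse y‖ + ‖A.inverse y‖ := by
    simpa using norm_sub_le (t - t₀ + A.inverse y) (A.inverse y)
  have h7 : ‖t - t₀‖ ≤ 2 * c * ‖y‖ := by
    have := mul_le_mul_of_nonneg_right hτ1 (norm_nonneg (t - t₀))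
    linarith [hL y]
  calc ‖t - t₀ + A.inverse y‖ ≤ c * τ * (2 * c * ‖y‖) :=
        h5.trans (mul_le_mul_of_nonneg_left h7 (by positivity))
    _ = c * τ * (2 * c) * ‖y‖ := by ring
    _ ≤ κ * ‖y‖ := mul_le_mul_of_nonneg_right hτ2 (norm_nonneg _)

/-- Asymptotic linearity of `Z`-estimators: `zeros_expansion` is multiplied by `√N`, and
`√N Ψ_N(t₀)` is bounded in probability. -/
theorem isInfluenceFunction (h : IsIIDSample μ ξ ν) (hg : IsRegular ν g B t₀)
    {est : ℕ → Ω → Vec e} (hest : IsSolution μ B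
      (fun N ω t => (1 / (N : ℝ)) • ∑ i ∈ Finset.range N, g t (ξ i ω)) est) :
    IsInfluenceFunction μ ξ est t₀ (fullInfluence ν g t₀) := by
  have hLp := hg.memLp_fullInfluence
  refine ⟨fun i => h.memLp_comp hLp i, fun i => ?_, ?_⟩
  · rw [h.integral_comp hLp.aestronglyMeasurable i]
    unfold fullInfluence
    rw [integral_neg, ContinuousLinearMap.integral_comp_comm _ (hg.integrable hg.mem),
      hg.moment_zero, map_zero, neg_zero]
  refine tendstoInMeasure_iff_norm.2 fun η hη => ENNReal.tendsto_nhds_zero.2 fun κ hκ => ?_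
  obtain ⟨C, hC⟩ : ∃ C, C = ∑ j, ∫ z, (g t₀ z j) ^ 2 ∂ν := ⟨_, rfl⟩
  -- `‖√N Ψ_N(t₀)‖ < M` up to probability `κ / 2`; then a relative error `η / (2 M)` suffices
  obtain ⟨M, hM, hMκ⟩ : ∃ M : ℝ, 0 < M ∧ ENNReal.ofReal (C / M ^ 2) ≤ κ / 2 := by
    have hlim : Tendsto (fun M : ℝ => ENNReal.ofReal (C / M ^ 2)) atTop (𝓝 0) := by
      rw [← ENNReal.ofReal_zero]
      exact ENNReal.tendsto_ofReal ((tendsto_pow_atTop two_ne_zero).const_div_atTop C)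
    have := (ENNReal.tendsto_nhds_zero.1 hlim (κ / 2) (ENNReal.half_pos hκ.ne')).and
      (eventually_gt_atTop 0)
    obtain ⟨M, h1, h2⟩ := this.exists
    exact ⟨M, h2, h1⟩
  have hgood : HoldsWHP μ _ :=
    (h.zeros_expansion hg (div_pos hη (mul_pos two_pos hM))).and hest.solves
  filter_upwards [ENNReal.tendsto_nhds_zero.1 hgood (κ / 2) (ENNReal.half_pos hκ.ne'),
    eventually_gt_atTop 0] with N hN hN0
  have hcheb := h.measure_norm_sum_ge_le hg.square_integrable hg.moment_zero hM hN0
  rw [← hC] at hcheb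
  rw [← ENNReal.add_halves κ]
  refine le_trans ((measure_mono ?_).trans (measure_union_le _ _))
    (add_le_add hN (hcheb.trans hMκ))
  intro ω hω
  simp only [Set.mem_ofPred_eq, Set.mem_union, sub_zero] at hω ⊢
  by_contra hcon
  push Not at hcon
  obtain ⟨⟨h1, h2, h3⟩, h4⟩ := hcon
  have hNpos : (0 : ℝ) < N := by exact_mod_cast hN0
  have hs : 0 < √(N : ℝ) := Real.sqrt_pos.2 hNpos
  have hsq : √(N : ℝ) * (1 / N) = (√(N : ℝ))⁻¹ := by
    rw [mul_one_div, Real.sqrt_div_self]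
  have h5 := h1 _ h2 h3
  have h6 : √(N : ℝ) • (est N ω - t₀)
      - (√(N : ℝ))⁻¹ • ∑ i ∈ Finset.range N, fullInfluence ν g t₀ (ξ i ω)
      = √(N : ℝ) • (est N ω - t₀ + (∫ z, fderiv ℝ (fun t => g t z) t₀ ∂ν).inverse
          ((1 / (N : ℝ)) • ∑ i ∈ Finset.range N, g t₀ (ξ i ω))) := by
    rw [smul_add, ← map_smul, smul_smul, hsq, map_smul, map_sum]
    simp [fullInfluence, sub_eq_add_neg]
  have h7 : √(N : ℝ) * ‖(1 / (N : ℝ)) • ∑ i ∈ Finset.range N, g t₀ (ξ i ω)‖ < M := by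
    refine lt_of_eq_of_lt ?_ h4
    rw [← hsq, mul_smul, norm_smul √(N : ℝ), Real.norm_of_nonneg hs.le]
  rw [h6, norm_smul, Real.norm_of_nonneg hs.le] at hω
  have h8 := mul_le_mul_of_nonneg_left h5 hs.le
  rw [mul_left_comm] at h8
  have h9 := mul_lt_mul_of_pos_left h7 (div_pos hη (mul_pos two_pos hM))
  have h10 : η / (2 * M) * M = η / 2 := by field_simp
  linarith

end IsIIDSample

end ZEstimation

/-! ### Reweighted estimating functions -/

section Reweighting

lemma fderiv_smul_comp {W Z : Type*} {c : W → ℝ} {z : W → Z} {e : ℕ} {g : Vec e → Z → Vec e} (w : W)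
    (t : Vec e) :
    fderiv ℝ (fun t => c w • g t (z w)) t = c w • fderiv ℝ (fun t => g t (z w)) t :=
  congrFun (fderiv_const_smul_field (𝕜 := ℝ) (f := fun t => g t (z w)) (c w)) t

variable {W Z : Type*} [MeasurableSpace W] [MeasurableSpace Z] {P : Measure W} {c : W → ℝ} {C : ℝ}
  {z : W → Z}

/-- If reweighting `P` by the density `c` does not change the law of `z`, then the weight `c` can be
dropped from expectations of functions of `z`. -/
lemma integral_smul_comp_of_map_withDensity {E : Type*} [NormedAddCommGroup E] [NormedSpace ℝ E]
    (hcm : Measurable c) (hc0 : ∀ᵐ w ∂P, 0 ≤ c w) (hz : Measurable z)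
    (hmap : (P.withDensity fun w => ENNReal.ofReal (c w)).map z = P.map z) {f : Z → E}
    (hf : AEStronglyMeasurable f (P.map z)) :
    ∫ w, c w • f (z w) ∂P = ∫ x, f x ∂(P.map z) := by
  rw [← hmap, integral_map hz.aemeasurable (by rwa [hmap]),
    integral_withDensity_eq_integral_toReal_smul₀ hcm.ennreal_ofReal.aemeasurable
      (Eventually.of_forall fun _ => ENNReal.ofReal_lt_top)]
  refine integral_congr_ae ?_
  filter_upwards [hc0] with w hw
  rw [ENNReal.toReal_ofReal hw]

variable {e : ℕ} {g : Vec e → Z → Vec e} {B : Set (Vec e)} {t₀ : Vec e}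

/-- Reweighting by the bounded weight `c` does not change the expected derivative. -/
lemma IsRegular.integral_fderiv_smul (hg : IsRegular (P.map z) g B t₀) (hcm : Measurable c)
    (hc0 : ∀ᵐ w ∂P, 0 ≤ c w) (hz : Measurable z)
    (hmap : (P.withDensity fun w => ENNReal.ofReal (c w)).map z = P.map z) :
    ∫ w, fderiv ℝ (fun t => c w • g t (z w)) t₀ ∂P
      = ∫ x, fderiv ℝ (fun t => g t x) t₀ ∂(P.map z) := by
  simp_rw [fderiv_smul_comp]
  exact integral_smul_comp_of_map_withDensity hcm hc0 hz hmap hg.aestronglyMeasurable_fderiv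

/-- A regular estimating function stays regular, with the same parameter, if it is multiplied by a
bounded weight that is conditionally unbiased. -/
lemma IsRegular.smul_weight (hg : IsRegular (P.map z) g B t₀) (hcm : Measurable c)
    (hc0 : ∀ᵐ w ∂P, 0 ≤ c w) (hcC : ∀ᵐ w ∂P, c w ≤ C) (hz : Measurable z)
    (hmap : (P.withDensity fun w => ENNReal.ofReal (c w)).map z = P.map z) :
    IsRegular P (fun t w => c w • g t (z w)) B t₀ where
  isCompact := hg.isCompact
  mem_interior := hg.mem_interior
  measurable t := hcm.smul ((hg.measurable t).comp hz)
  continuousOn := by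
    filter_upwards [ae_of_ae_map hz.aemeasurable hg.continuousOn] with w hw
    exact hw.const_smul (c w)
  envelope := by
    obtain ⟨F, hF, hgF⟩ := hg.envelope
    refine ⟨fun w => C * F (z w), (hF.comp_measurable hz).const_mul C, ?_⟩
    filter_upwards [hc0, hcC, ae_of_ae_map hz.aemeasurable hgF] with w h0 h1 hw t ht
    rw [norm_smul, Real.norm_of_nonneg h0]
    exact mul_le_mul h1 (hw t ht) (norm_nonneg _) (h0.trans h1)
  moment_zero := by
    rw [integral_smul_comp_of_map_withDensity hcm hc0 hz hmap
      (hg.measurable t₀).aestronglyMeasurable, hg.moment_zero]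
  identification t ht h0 := hg.identification t ht <| by
    rwa [integral_smul_comp_of_map_withDensity hcm hc0 hz hmap
      (hg.measurable t).aestronglyMeasurable] at h0
  square_integrable := by
    refine (hg.square_integrable.comp_of_map hz.aemeasurable).of_le_mul (c := C)
      (hcm.smul ((hg.measurable t₀).comp hz)).aestronglyMeasurable ?_
    filter_upwards [hc0, hcC] with w h0 h1
    rw [norm_smul, Real.norm_of_nonneg h0]
    exact mul_le_mul_of_nonneg_right h1 (norm_nonneg _)
  smooth := by
    obtain ⟨U, hU, htU, hC, G, hG, hbound⟩ := hg.smooth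
    refine ⟨U, hU, htU, ?_, fun w => C * G (z w), (hG.comp_measurable hz).const_mul C, ?_⟩
    · filter_upwards [ae_of_ae_map hz.aemeasurable hC] with w hw using hw.const_smul (c w)
    · filter_upwards [hc0, hcC, ae_of_ae_map hz.aemeasurable hbound] with w h0 h1 hw t ht
      rw [fderiv_smul_comp, norm_smul, Real.norm_of_nonneg h0]
      exact mul_le_mul h1 (hw t ht) (norm_nonneg _) (h0.trans h1)
  jacobian_invertible := by
    rw [hg.integral_fderiv_smul hcm hc0 hz hmap]
    exact hg.jacobian_invertible

lemma IsRegular.fullInfluence_smul (hg : IsRegular (P.map z) g B t₀) (hcm : Measurable c)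
    (hc0 : ∀ᵐ w ∂P, 0 ≤ c w) (hz : Measurable z)
    (hmap : (P.withDensity fun w => ENNReal.ofReal (c w)).map z = P.map z) (w : W) :
    fullInfluence P (fun t w => c w • g t (z w)) t₀ w
      = c w • fullInfluence (P.map z) g t₀ (z w) := by
  rw [fullInfluence, fullInfluence, hg.integral_fderiv_smul hcm hc0 hz hmap, map_smul, smul_neg]

end Reweighting

/-! ### Inverse probability weights -/

/-- The inverse probability weight `R / ρ(x, s)` of an observation. -/
def ipWeight {p K : ℕ} (ρ : Vec p → Vec K → ℝ) (w : Obs p K) : ℝ := w.2.2.2 / ρ w.1 w.2.1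

/-- An observation `(x, s, y)` without the labeling indicator. -/
def unlabeled {p K : ℕ} (w : Obs p K) : Vec p × Vec K × ℝ := (w.1, w.2.1, w.2.2.1)

lemma measurable_unlabeled {p K : ℕ} : Measurable (unlabeled : Obs p K → _) := by
  unfold unlabeled; fun_prop

lemma measurable_labelData {p K : ℕ} : Measurable (labelData : Obs p K → _) := by
  unfold labelData; fun_prop

lemma measurable_surrogateData {p K : ℕ} (k : Fin K) :
    Measurable (surrogateData k : Obs p K → _) := by
  unfold surrogateData; fun_prop

namespace IsPoissonDesign

variable {Ω : Type*} [MeasurableSpace Ω] {μ : Measure Ω} {p K : ℕ}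
  {X : ℕ → Ω → Vec p} {S : ℕ → Ω → Vec K} {Y R : ℕ → Ω → ℝ} {ρ : Vec p → Vec K → ℝ}

lemma measurable_obs (hd : IsPoissonDesign μ X S Y R ρ) (i : ℕ) : Measurable (obs X S Y R i) :=
  (hd.measurable_X i).prodMk
    ((hd.measurable_S i).prodMk ((hd.measurable_Y i).prodMk (hd.measurable_R i)))

lemma isIIDSample (hd : IsPoissonDesign μ X S Y R ρ) :
    IsIIDSample μ (obs X S Y R) (μ.map (obs X S Y R 0)) :=
  ⟨hd.measurable_obs, hd.indep, fun i => (hd.ident i).map_eq⟩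

lemma rho_pos (hd : IsPoissonDesign μ X S Y R ρ) (x : Vec p) (s : Vec K) : 0 < ρ x s := by
  obtain ⟨ε, hε, h⟩ := hd.positivity
  exact hε.trans_le (h x s)

lemma exists_one_div_rho_le (hd : IsPoissonDesign μ X S Y R ρ) : ∃ C, ∀ x s, 1 / ρ x s ≤ C := by
  obtain ⟨ε, hε, h⟩ := hd.positivity
  exact ⟨1 / ε, fun x s => one_div_le_one_div_of_le hε (h x s)⟩

lemma measurable_ipWeight (hd : IsPoissonDesign μ X S Y R ρ) :
    Measurable (ipWeight (K := K) ρ) := by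
  have : Measurable fun w : Obs p K => ρ w.1 w.2.1 :=
    hd.measurable_rho.comp (by fun_prop : Measurable fun w : Obs p K => (w.1, w.2.1))
  exact Measurable.div (by fun_prop) this

lemma ipWeight_nonneg (hd : IsPoissonDesign μ X S Y R ρ) (i : ℕ) (ω : Ω) :
    0 ≤ ipWeight ρ (obs X S Y R i ω) :=
  div_nonneg (by rcases hd.binary i ω with h | h <;> simp [obs, h]) (hd.rho_pos _ _).le

lemma ipWeight_le (hd : IsPoissonDesign μ X S Y R ρ) {C : ℝ} (hC : ∀ x s, 1 / ρ x s ≤ C)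
    (i : ℕ) (ω : Ω) : ipWeight ρ (obs X S Y R i ω) ≤ C := by
  refine le_trans (div_le_div_of_nonneg_right ?_ (hd.rho_pos _ _).le) (hC (X i ω) (S i ω))
  rcases hd.binary i ω with h | h <;> simp [obs, h]

lemma ae_map_ipWeight_nonneg (hd : IsPoissonDesign μ X S Y R ρ) :
    ∀ᵐ w ∂(μ.map (obs X S Y R 0)), 0 ≤ ipWeight ρ w :=
  (ae_map_iff (hd.measurable_obs 0).aemeasurable
    (measurableSet_le measurable_const hd.measurable_ipWeight)).2
    (Eventually.of_forall (hd.ipWeight_nonneg 0))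

lemma ae_map_ipWeight_le (hd : IsPoissonDesign μ X S Y R ρ) {C : ℝ} (hC : ∀ x s, 1 / ρ x s ≤ C) :
    ∀ᵐ w ∂(μ.map (obs X S Y R 0)), ipWeight ρ w ≤ C :=
  (ae_map_iff (hd.measurable_obs 0).aemeasurable
    (measurableSet_le hd.measurable_ipWeight measurable_const)).2
    (Eventually.of_forall (hd.ipWeight_le hC 0))

lemma integrable_R [IsProbabilityMeasure μ] (hd : IsPoissonDesign μ X S Y R ρ) (i : ℕ) :
    Integrable (R i) μ :=
  Integrable.of_bound (hd.measurable_R i).aestronglyMeasurable 1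
    (Eventually.of_forall fun ω => by rcases hd.binary i ω with h | h <;> simp [h])

lemma integral_R [IsProbabilityMeasure μ] (hd : IsPoissonDesign μ X S Y R ρ) (i : ℕ) :
    ∫ ω, R i ω ∂μ = ∫ ω, ρ (X i ω) (S i ω) ∂μ := by
  have hm : MeasurableSpace.comap (fun ω => (X i ω, S i ω, Y i ω)) inferInstance
      ≤ (inferInstance : MeasurableSpace Ω) :=
    ((hd.measurable_X i).prodMk ((hd.measurable_S i).prodMk (hd.measurable_Y i))).comap_le
  rw [← integral_condExp hm]
  exact integral_congr_ae (hd.selection i)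

/-- The weights are conditionally unbiased: reweighting by `R / ρ(x, s)` does not change the law of
`(x, s, y)`. -/
lemma map_withDensity_ipWeight [IsProbabilityMeasure μ] (hd : IsPoissonDesign μ X S Y R ρ) :
    ((μ.map (obs X S Y R 0)).withDensity fun w => ENNReal.ofReal (ipWeight ρ w)).map unlabeled
      = (μ.map (obs X S Y R 0)).map unlabeled := by
  obtain ⟨C, hC⟩ := hd.exists_one_div_rho_le
  set T : Ω → Vec p × Vec K × ℝ := fun ω => (X 0 ω, S 0 ω, Y 0 ω) with hT
  have hTm : Measurable T :=
    (hd.measurable_X 0).prodMk ((hd.measurable_S 0).prodMk (hd.measurable_Y 0))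
  have hm : MeasurableSpace.comap T inferInstance ≤ (inferInstance : MeasurableSpace Ω) :=
    hTm.comap_le
  have hwm : Measurable fun ω => ipWeight ρ (obs X S Y R 0 ω) :=
    hd.measurable_ipWeight.comp (hd.measurable_obs 0)
  have hint : Integrable (fun ω => ipWeight ρ (obs X S Y R 0 ω)) μ :=
    Integrable.of_bound hwm.aestronglyMeasurable C (Eventually.of_forall fun ω => by
      rw [Real.norm_of_nonneg (hd.ipWeight_nonneg 0 ω)]
      exact hd.ipWeight_le hC 0 ω)
  have hcond : μ[fun ω => ipWeight ρ (obs X S Y R 0 ω) | MeasurableSpace.comap T inferInstance]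
      =ᵐ[μ] fun _ => 1 := by
    have hinv : StronglyMeasurable[MeasurableSpace.comap T inferInstance]
        fun ω => (ρ (X 0 ω) (S 0 ω))⁻¹ := by
      have h1 : Measurable fun t : Vec p × Vec K × ℝ => (ρ t.1 t.2.1)⁻¹ :=
        (hd.measurable_rho.comp
          (by fun_prop : Measurable fun t : Vec p × Vec K × ℝ => (t.1, t.2.1))).inv
      exact (h1.comp (comap_measurable T)).stronglyMeasurable
    have heq : (fun ω => ipWeight ρ (obs X S Y R 0 ω))
        = (fun ω => (ρ (X 0 ω) (S 0 ω))⁻¹) * R 0 := by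
      ext ω
      simp [ipWeight, obs, div_eq_inv_mul]
    rw [heq] at hint ⊢
    filter_upwards [condExp_mul_of_stronglyMeasurable_left hinv hint (hd.integrable_R 0),
      hd.selection 0] with ω h1 h2
    rw [h1, Pi.mul_apply]
    exact (congrArg ((ρ (X 0 ω) (S 0 ω))⁻¹ * ·) h2).trans (inv_mul_cancel₀ (hd.rho_pos _ _).ne')
  ext s hs
  rw [Measure.map_apply measurable_unlabeled hs, withDensity_apply _ (measurable_unlabeled hs),
    setLIntegral_map (measurable_unlabeled hs) hd.measurable_ipWeight.ennreal_ofReal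
      (hd.measurable_obs 0),
    Measure.map_apply measurable_unlabeled hs,
    Measure.map_apply (hd.measurable_obs 0) (measurable_unlabeled hs),
    ← ofReal_integral_eq_lintegral_ofReal hint.integrableOn
      (Eventually.of_forall fun ω => hd.ipWeight_nonneg 0 ω)]
  have hpre : obs X S Y R 0 ⁻¹' (unlabeled ⁻¹' s) = T ⁻¹' s := rfl
  rw [hpre, ← setIntegral_condExp hm hint ⟨s, hs, rfl⟩,
    setIntegral_congr_ae (hTm hs) (hcond.mono fun ω hω _ => hω)]
  simp

/-- The law of any measurable function of `(x, s, y)` is unchanged by the weights. -/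
lemma map_withDensity_ipWeight_comp [IsProbabilityMeasure μ] (hd : IsPoissonDesign μ X S Y R ρ)
    {Z : Type*} [MeasurableSpace Z] {z : Vec p × Vec K × ℝ → Z} (hz : Measurable z) :
    ((μ.map (obs X S Y R 0)).withDensity fun w => ENNReal.ofReal (ipWeight ρ w)).map
        (fun w => z (unlabeled w))
      = (μ.map (obs X S Y R 0)).map fun w => z (unlabeled w) := by
  have h := congrArg (Measure.map z) hd.map_withDensity_ipWeight
  rwa [Measure.map_map hz measurable_unlabeled, Measure.map_map hz measurable_unlabeled] at h

/-- `E {R f(x, s, y) / ρ(x, s)} = E f(x, s, y)`. -/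
lemma integral_ipWeight_mul [IsProbabilityMeasure μ] (hd : IsPoissonDesign μ X S Y R ρ)
    {f : Obs p K → ℝ} {f' : Vec p × Vec K × ℝ → ℝ} (hff : ∀ w, f w = f' (unlabeled w))
    (hf' : Measurable f') :
    ∫ ω, ipWeight ρ (obs X S Y R 0 ω) * f (obs X S Y R 0 ω) ∂μ
      = ∫ ω, f (obs X S Y R 0 ω) ∂μ := by
  have h := integral_smul_comp_of_map_withDensity hd.measurable_ipWeight hd.ae_map_ipWeight_nonneg
    measurable_unlabeled hd.map_withDensity_ipWeight hf'.aestronglyMeasurable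
  have hfm : Measurable f := by
    rw [funext hff]; exact hf'.comp measurable_unlabeled
  rw [integral_map measurable_unlabeled.aemeasurable hf'.aestronglyMeasurable] at h
  simp_rw [← hff, smul_eq_mul] at h
  have hwf : Measurable fun w => ipWeight ρ w * f w := hd.measurable_ipWeight.mul hfm
  rwa [integral_map (hd.measurable_obs 0).aemeasurable hwf.aestronglyMeasurable,
    integral_map (hd.measurable_obs 0).aemeasurable hfm.aestronglyMeasurable] at h

/-! ### Influence functions of the full data and of the validation set estimators -/

/-- As `R` is binary, the sum over the validation set is a sum over the whole sample with weights
`R / ρ`. -/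
lemma validationEq_eq {Z : Type*} {z : Obs p K → Z} {e : ℕ} {g : Vec e → Z → Vec e}
    (hd : IsPoissonDesign μ X S Y R ρ) (N : ℕ) (ω : Ω) (t : Vec e) :
    validationEq X S Y R ρ z g N ω t = (1 / (N : ℝ)) • ∑ i ∈ Finset.range N,
      ipWeight ρ (obs X S Y R i ω) • g t (z (obs X S Y R i ω)) := by
  classical
  unfold validationEq validationSet
  rw [Finset.sum_filter]
  congr 1
  refine Finset.sum_congr rfl fun i _ => ?_
  rcases hd.binary i ω with h | h <;> simp [ipWeight, obs, h]

variable {Z : Type*} [MeasurableSpace Z] {z : Obs p K → Z} {e : ℕ} {g : Vec e → Z → Vec e}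
  {B : Set (Vec e)} {t₀ : Vec e} {est : ℕ → Ω → Vec e}

theorem isInfluenceFunction_full [IsProbabilityMeasure μ] (hd : IsPoissonDesign μ X S Y R ρ)
    (hz : Measurable z) (hg : IsRegular ((μ.map (obs X S Y R 0)).map z) g B t₀)
    (hest : IsSolution μ B (fullEq X S Y R z g) est) :
    IsInfluenceFunction μ (obs X S Y R) est t₀
      fun w => fullInfluence ((μ.map (obs X S Y R 0)).map z) g t₀ (z w) := by
  have h := (hd.isIIDSample.comp hz).isInfluenceFunction hg hest
  exact ⟨h.memLp, h.mean_zero, h.expansion⟩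

/-- The influence function of an inverse probability weighted estimator. The weighted estimating
function is itself a regular estimating function for the law of a full observation. -/
theorem isInfluenceFunction_validation [IsProbabilityMeasure μ]
    (hd : IsPoissonDesign μ X S Y R ρ) {z' : Vec p × Vec K × ℝ → Z} (hz' : Measurable z')
    (hzz' : z = fun w => z' (unlabeled w))
    (hg : IsRegular ((μ.map (obs X S Y R 0)).map z) g B t₀)
    (hest : IsSolution μ B (validationEq X S Y R ρ z g) est) :
    IsInfluenceFunction μ (obs X S Y R) est t₀ fun w => ipWeight ρ w •
      fullInfluence ((μ.map (obs X S Y R 0)).map z) g t₀ (z w) := by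
  have hz : Measurable z := by rw [hzz']; exact hz'.comp measurable_unlabeled
  have hmap : ((μ.map (obs X S Y R 0)).withDensity
      fun w => ENNReal.ofReal (ipWeight ρ w)).map z = (μ.map (obs X S Y R 0)).map z := by
    rw [hzz']; exact hd.map_withDensity_ipWeight_comp hz'
  obtain ⟨C, hC⟩ := hd.exists_one_div_rho_le
  have hreg := hg.smul_weight hd.measurable_ipWeight hd.ae_map_ipWeight_nonneg
    (hd.ae_map_ipWeight_le hC) hz hmap
  have heq : validationEq X S Y R ρ z g = fun (N : ℕ) ω t => (1 / (N : ℝ)) • ∑ i ∈ Finset.range N,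
      ipWeight ρ (obs X S Y R i ω) • g t (z (obs X S Y R i ω)) := by
    ext1 N; ext1 ω; ext1 t; exact hd.validationEq_eq N ω t
  rw [heq] at hest
  have h := hd.isIIDSample.isInfluenceFunction hreg hest
  rwa [funext (hg.fullInfluence_smul hd.measurable_ipWeight hd.ae_map_ipWeight_nonneg hz hmap)] at h

end IsPoissonDesign

section LimitTheorems

variable {Ω : Type*} [MeasurableSpace Ω] {μ : Measure Ω}

/-! ### Calculus of influence functions -/

namespace IsInfluenceFunction

variable {W : Type*} {w : ℕ → Ω → W} {e e' : ℕ} {est est' : ℕ → Ω → Vec e} {t₀ t₀' : Vec e}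
  {φ φ' : W → Vec e}

lemma zero : IsInfluenceFunction μ w (fun _ _ => (0 : Vec e)) 0 fun _ => 0 where
  memLp _ := MemLp.zero'
  mean_zero _ := integral_zero _ _
  expansion := tendstoInMeasure_iff_norm.2 fun ε hε => by simp [hε.not_ge]

variable [IsProbabilityMeasure μ]

lemma add (h : IsInfluenceFunction μ w est t₀ φ) (h' : IsInfluenceFunction μ w est' t₀' φ') :
    IsInfluenceFunction μ w (fun N ω => est N ω + est' N ω) (t₀ + t₀') fun x => φ x + φ' x where
  memLp i := (h.memLp i).add (h'.memLp i)
  mean_zero i := by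
    rw [integral_add ((h.memLp i).integrable (by norm_num)) ((h'.memLp i).integrable (by norm_num)),
      h.mean_zero, h'.mean_zero, add_zero]
  expansion := by
    have := tendstoInMeasure_add h.expansion h'.expansion
    rw [add_zero] at this
    refine this.congr_left fun N => Eventually.of_forall fun ω => ?_
    simp only [Finset.sum_add_distrib, smul_add, smul_sub]
    abel

lemma clm_apply (L : Vec e →L[ℝ] Vec e') (h : IsInfluenceFunction μ w est t₀ φ) :
    IsInfluenceFunction μ w (fun N ω => L (est N ω)) (L t₀) fun x => L (φ x) where
  memLp i := L.comp_memLp' (h.memLp i)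
  mean_zero i := by
    rw [L.integral_comp_comm ((h.memLp i).integrable (by norm_num)), h.mean_zero, map_zero]
  expansion := by
    refine (tendstoInMeasure_clm_apply L h.expansion).congr_left
      fun N => Eventually.of_forall fun ω => ?_
    simp only [map_sub, map_smul, map_sum]

lemma sub (h : IsInfluenceFunction μ w est t₀ φ) (h' : IsInfluenceFunction μ w est' t₀' φ') :
    IsInfluenceFunction μ w (fun N ω => est N ω - est' N ω) (t₀ - t₀') fun x => φ x - φ' x := by
  simpa [sub_eq_add_neg] using h.add (h'.clm_apply (-ContinuousLinearMap.id ℝ (Vec e)))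

lemma sum {ι : Type*} {est : ι → ℕ → Ω → Vec e} {t₀ : ι → Vec e} {φ : ι → W → Vec e}
    (s : Finset ι) (h : ∀ k, IsInfluenceFunction μ w (est k) (t₀ k) (φ k)) :
    IsInfluenceFunction μ w (fun N ω => ∑ k ∈ s, est k N ω) (∑ k ∈ s, t₀ k)
      fun x => ∑ k ∈ s, φ k x := by
  classical
  induction s using Finset.induction_on with
  | empty => simpa using zero
  | insert k s hk ih =>
    simp only [Finset.sum_insert hk]
    exact (h k).add ih

end IsInfluenceFunction

/-! ### The multivariate central limit theorem -/

lemma covMatrix_isHermitian {p : ℕ} (V : Ω → Vec p) : (covMatrix μ V).IsHermitian := by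
  ext a b
  simp [covMatrix, covariance_comm]

lemma variance_inner_eq [IsProbabilityMeasure μ] {p : ℕ} {V : Ω → Vec p} (hV : MemLp V 2 μ)
    (t : Vec p) :
    Var[fun ω => inner ℝ (V ω) t; μ] = t.ofLp ⬝ᵥ (covMatrix μ V).mulVec t.ofLp := by
  have hVj : ∀ a, MemLp (fun ω => V ω a) 2 μ := fun a =>
    (EuclideanSpace.proj (𝕜 := ℝ) a).comp_memLp' hV
  have h1 : (fun ω => inner ℝ (V ω) t) = fun ω => ∑ a, t a * V ω a := by
    ext ω
    simp [PiLp.inner_apply]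
  rw [h1, variance_fun_sum' fun a _ => (hVj a).const_mul (t a)]
  simp_rw [covariance_const_mul_left, covariance_const_mul_right]
  simp only [dotProduct, Matrix.mulVec, covMatrix, Matrix.of_apply, Finset.mul_sum]
  exact Finset.sum_congr rfl fun a _ => Finset.sum_congr rfl fun b _ => by ring

lemma covMatrix_posSemidef [IsProbabilityMeasure μ] {p : ℕ} {V : Ω → Vec p} (hV : MemLp V 2 μ) :
    (covMatrix μ V).PosSemidef :=
  Matrix.PosSemidef.of_dotProduct_mulVec_nonneg (covMatrix_isHermitian V) fun x => by
    have := variance_inner_eq hV (WithLp.toLp 2 x)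
    rw [star_trivial]
    exact this ▸ variance_nonneg _ _

lemma charFun_map_eq_charFun_map_inner {p : ℕ} {V : Ω → Vec p} (hV : AEMeasurable V μ) (t : Vec p) :
    charFun (μ.map V) t = charFun (μ.map fun ω => inner ℝ (V ω) t) 1 := by
  rw [charFun_apply, charFun_apply_real, integral_map hV (by fun_prop),
    integral_map (by fun_prop) (by fun_prop)]
  simp

/-- The central limit theorem for i.i.d. random vectors, from the one-dimensional one by the
Cramér-Wold device. -/
theorem IsIIDSample.tendstoInDistribution_sum {Z : Type*} [MeasurableSpace Z] {ξ : ℕ → Ω → Z}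
    {ν : Measure Z} [IsProbabilityMeasure μ] (h : IsIIDSample μ ξ ν) {p : ℕ} {f : Z → Vec p}
    (hf : MemLp f 2 ν) (hf0 : ∫ z, f z ∂ν = 0) :
    TendstoInDistribution
      (fun (N : ℕ) ω => (√(N : ℝ))⁻¹ • ∑ i ∈ Finset.range N, f (ξ i ω)) atTop
      (fun v : Vec p => v) (fun _ => μ)
      (multivariateGaussian 0 (covMatrix μ fun ω => f (ξ 0 ω))) := by
  have := h.isProbabilityMeasure
  have hfi : ∀ i, AEMeasurable (fun ω => f (ξ i ω)) μ := fun i =>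
    (h.memLp_comp hf i).aestronglyMeasurable.aemeasurable
  have hmeas : ∀ N : ℕ, AEMeasurable
      (fun ω => (√(N : ℝ))⁻¹ • ∑ i ∈ Finset.range N, f (ξ i ω)) μ := fun N =>
    (Finset.aemeasurable_fun_sum _ fun i _ => hfi i).const_smul (√(N : ℝ))⁻¹
  refine ⟨hmeas, by fun_prop, ProbabilityMeasure.tendsto_iff_tendsto_charFun.2 fun t => ?_⟩
  have hinner : MemLp (fun z => inner ℝ (f z) t) 2 ν := by
    simpa [real_inner_comm, Function.comp_def] using (innerSL ℝ t).comp_memLp' hf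
  have hE : ∫ ω, inner ℝ (f (ξ 0 ω)) t ∂μ = 0 := by
    rw [h.integral_comp (f := fun z => inner ℝ (f z) t) hinner.aestronglyMeasurable]
    have := (innerSL ℝ t).integral_comp_comm (hf.integrable (by norm_num))
    simpa [real_inner_comm, hf0] using this
  have hclt := tendstoInDistribution_inv_sqrt_mul_sum_sub (P := μ)
    (X := fun i ω => inner ℝ (f (ξ i ω)) t) (Y := fun x : ℝ => x)
    (P' := gaussianReal 0 Var[fun ω => inner ℝ (f (ξ 0 ω)) t; μ].toNNReal)
    ⟨by fun_prop, by simp⟩ (h.memLp_comp hinner 0)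
    (h.iIndepFun_comp (f := fun z => inner ℝ (f z) t) hinner.aestronglyMeasurable.aemeasurable)
    (h.identDistrib_comp (f := fun z => inner ℝ (f z) t) hinner.aestronglyMeasurable.aemeasurable)
  have hlim := ProbabilityMeasure.tendsto_iff_tendsto_charFun.1 hclt.tendsto 1
  simp only [ProbabilityMeasure.coe_mk, Measure.map_id'] at hlim ⊢
  rw [charFun_multivariateGaussian (covMatrix_posSemidef (h.memLp_comp hf 0)),
    ← variance_inner_eq (h.memLp_comp hf 0)]
  rw [charFun_gaussianReal] at hlim
  have hlimit : Complex.exp (((1 : ℝ) : ℂ) * ((0 : ℝ) : ℂ) * Complex.I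
      - ((Var[fun ω => inner ℝ (f (ξ 0 ω)) t; μ].toNNReal : ℝ) : ℂ) * ((1 : ℝ) : ℂ) ^ 2 / 2)
      = Complex.exp (((inner ℝ t (0 : Vec p) : ℝ) : ℂ) * Complex.I
        - ((Var[fun ω => inner ℝ (f (ξ 0 ω)) t; μ] : ℝ) : ℂ) / 2) := by
    rw [Real.coe_toNNReal _ (variance_nonneg _ _)]
    simp
  rw [← hlimit]
  refine hlim.congr fun N => ?_
  rw [charFun_map_eq_charFun_map_inner (hmeas N)]
  congr 2
  ext ω
  rw [hE, mul_zero, sub_zero, inner_smul_left, sum_inner]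
  simp

/-- Slutsky's theorem for an asymptotically linear estimator that is normalised by the square root
of a random sample size `n` with `n / N → r`. -/
theorem tendstoInDistribution_random_norm {W : Type*} [MeasurableSpace W] {w : ℕ → Ω → W}
    {ν : Measure W} [IsProbabilityMeasure μ] (hw : IsIIDSample μ w ν) {p : ℕ}
    {est : ℕ → Ω → Vec p} {t₀ : Vec p} {φ : W → Vec p} (h : IsInfluenceFunction μ w est t₀ φ)
    (hφ : AEStronglyMeasurable φ ν)
    (hest : ∀ N, AEMeasurable (est N) μ) {n : ℕ → Ω → ℝ} (hn : ∀ N, AEMeasurable (n N) μ)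
    (hn0 : ∀ ω, n 0 ω = 0) {r : ℝ} (hr : 0 ≤ r)
    (hnr : TendstoInMeasure μ (fun (N : ℕ) ω => (1 / (N : ℝ)) * n N ω) atTop fun _ => r) :
    TendstoInDistribution (fun (N : ℕ) ω => √(n N ω) • (est N ω - t₀)) atTop
      (fun v : Vec p => v) (fun _ => μ)
      (multivariateGaussian 0 (r • covMatrix μ fun ω => φ (w 0 ω))) := by
  have hφLp : MemLp φ 2 ν := by
    rw [← hw.law 0] at hφ ⊢
    exact (memLp_map_measure_iff hφ (hw.measurable 0).aemeasurable).2 (h.memLp 0)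
  have hclt := hw.tendstoInDistribution_sum hφLp (by
    rw [← hw.integral_comp hφ 0, h.mean_zero])
  have hexp : TendstoInDistribution (fun (N : ℕ) ω => √(N : ℝ) • (est N ω - t₀)) atTop
      (fun v : Vec p => v) (fun _ => μ)
      (multivariateGaussian 0 (covMatrix μ fun ω => φ (w 0 ω))) :=
    tendstoInDistribution_of_tendstoInMeasure_sub _ _ hclt h.expansion
      fun N => ((hest N).sub_const t₀).const_smul √(N : ℝ)
  have hsl := hexp.continuous_comp_prodMk_of_tendstoInMeasure_const
    (g := fun x : Vec p × ℝ => √x.2 • x.1) (by fun_prop) hnr fun N => (hn N).const_mul _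
  have hfun : ∀ (N : ℕ) (ω : Ω), √((1 / (N : ℝ)) * n N ω) • √(N : ℝ) • (est N ω - t₀)
      = √(n N ω) • (est N ω - t₀) := fun N ω => by
    rcases Nat.eq_zero_or_pos N with rfl | hN
    -- for `N = 0` the quotient `n / N` is the junk value `0`, but `n = 0` as well
    · simp [hn0]
    · have hNpos : (0 : ℝ) < N := by exact_mod_cast hN
      rw [smul_smul, Real.sqrt_mul (by positivity), mul_right_comm, ← Real.sqrt_mul (by positivity),
        one_div, inv_mul_cancel₀ hNpos.ne', Real.sqrt_one, one_mul]
  simp only [hfun] at hsl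
  have hPSD := covMatrix_posSemidef (h.memLp 0)
  have hlaw : (multivariateGaussian 0 (covMatrix μ fun ω => φ (w 0 ω))).map
      (fun v : Vec p => √r • v) = multivariateGaussian 0 (r • covMatrix μ fun ω => φ (w 0 ω)) := by
    have := Measure.isProbabilityMeasure_map (μ := multivariateGaussian 0
      (covMatrix μ fun ω => φ (w 0 ω))) (f := fun v : Vec p => √r • v) (by fun_prop)
    refine Measure.ext_of_charFun (funext fun t => ?_)
    rw [charFun_map_smul, charFun_multivariateGaussian hPSD,
      charFun_multivariateGaussian (hPSD.smul hr)]
    have hs : ((√r : ℝ) : ℂ) * ((√r : ℝ) : ℂ) = (r : ℂ) := by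
      rw [← Complex.ofReal_mul, Real.mul_self_sqrt hr]
    simp [Matrix.mulVec_smul, Matrix.smul_mulVec, ← mul_assoc, hs]
  refine ⟨hsl.forall_aemeasurable, by fun_prop, ?_⟩
  have hlim := hsl.tendsto
  have hlaw' : (⟨(multivariateGaussian 0 (r • covMatrix μ fun ω => φ (w 0 ω))).map
        (fun v : Vec p => v), Measure.isProbabilityMeasure_map (by fun_prop)⟩ :
        ProbabilityMeasure (Vec p))
      = ⟨(multivariateGaussian 0 (covMatrix μ fun ω => φ (w 0 ω))).map (fun v : Vec p => √r • v),
        Measure.isProbabilityMeasure_map (by fun_prop)⟩ :=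
    Subtype.ext (by simpa using hlaw.symm)
  rw [hlaw']
  exact hlim

end LimitTheorems

/-! ### The surrogate-powered estimator -/

/-- The block of the matrix `Γ` that acts on the `k`-th component of a stacked vector. -/
def blockCLM {p K d : ℕ} (Γ : Matrix (Fin p) (Fin K × Fin d) ℝ) (k : Fin K) : Vec d →L[ℝ] Vec p :=
  LinearMap.toContinuousLinearMap (Matrix.toLpLin 2 2 (Γ.submatrix id (Prod.mk k)))

lemma matVec_stack {p K d : ℕ} (Γ : Matrix (Fin p) (Fin K × Fin d) ℝ) (v : Fin K → Vec d) :
    matVec Γ (stack v) = ∑ k, blockCLM Γ k (v k) := by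
  ext a
  simp [matVec, stack, blockCLM, Matrix.mulVec, dotProduct, Fintype.sum_prod_type]

lemma stack_sub {K d : ℕ} (v v' : Fin K → Vec d) : stack v - stack v' = stack fun k => v k - v' k :=
  rfl

lemma spiInfluence_eq {p K d : ℕ} {ρ : Vec p → Vec K → ℝ} (hρ : ∀ x s, 0 < ρ x s)
    (Γ : Matrix (Fin p) (Fin K × Fin d) ℝ) (ψ : Obs p K → Vec p) (η : Obs p K → StackedVec K d)
    (w : Obs p K) :
    spiInfluence ρ Γ ψ η w = ipWeight ρ w • ψ w + (1 - ipWeight ρ w) • matVec Γ (η w) := by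
  rw [spiInfluence, sub_div, div_self (hρ _ _).ne']
  rfl

namespace IsPoissonDesign

variable {Ω : Type*} [MeasurableSpace Ω] {μ : Measure Ω} {p K : ℕ}
  {X : ℕ → Ω → Vec p} {S : ℕ → Ω → Vec K} {Y R : ℕ → Ω → ℝ} {ρ : Vec p → Vec K → ℝ}

lemma ipWeight_sq (hd : IsPoissonDesign μ X S Y R ρ) (i : ℕ) (ω : Ω) :
    ipWeight ρ (obs X S Y R i ω) ^ 2
      = ipWeight ρ (obs X S Y R i ω) * (1 / ρ (X i ω) (S i ω)) := by
  rcases hd.binary i ω with h | h <;> simp [ipWeight, obs, h, sq]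

lemma card_validationSet (hd : IsPoissonDesign μ X S Y R ρ) (N : ℕ) (ω : Ω) :
    ((validationSet R N ω).card : ℝ) = ∑ i ∈ Finset.range N, R i ω := by
  classical
  rw [validationSet, Finset.card_filter, Nat.cast_sum]
  refine Finset.sum_congr rfl fun i _ => ?_
  rcases hd.binary i ω with h | h <;> simp [h]

variable [IsProbabilityMeasure μ]

/-- The second moments of `W u + (1 - W) v`, where `W = R / ρ(x, s)` and `u, v` are functions of
`(x, s, y)`. As `W² = W / ρ`, the product is affine in `W`, and `W` has conditional mean one. -/
lemma integral_mul_ipWeight_comb (hd : IsPoissonDesign μ X S Y R ρ)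
    {u u' v v' : Vec p × Vec K × ℝ → ℝ} (hu : Measurable u) (hu' : Measurable u')
    (hv : Measurable v) (hv' : Measurable v')
    (hu2 : MemLp (fun ω => u (unlabeled (obs X S Y R 0 ω))) 2 μ)
    (hu2' : MemLp (fun ω => u' (unlabeled (obs X S Y R 0 ω))) 2 μ)
    (hv2 : MemLp (fun ω => v (unlabeled (obs X S Y R 0 ω))) 2 μ)
    (hv2' : MemLp (fun ω => v' (unlabeled (obs X S Y R 0 ω))) 2 μ) :
    ∫ ω, (ipWeight ρ (obs X S Y R 0 ω) * u (unlabeled (obs X S Y R 0 ω))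
          + (1 - ipWeight ρ (obs X S Y R 0 ω)) * v (unlabeled (obs X S Y R 0 ω)))
        * (ipWeight ρ (obs X S Y R 0 ω) * u' (unlabeled (obs X S Y R 0 ω))
          + (1 - ipWeight ρ (obs X S Y R 0 ω)) * v' (unlabeled (obs X S Y R 0 ω))) ∂μ
      = ∫ ω, (1 / ρ (X 0 ω) (S 0 ω)) * (u (unlabeled (obs X S Y R 0 ω))
          * u' (unlabeled (obs X S Y R 0 ω))) ∂μ
        - ∫ ω, ((1 - ρ (X 0 ω) (S 0 ω)) / ρ (X 0 ω) (S 0 ω))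
          * (u (unlabeled (obs X S Y R 0 ω)) * v' (unlabeled (obs X S Y R 0 ω))
            + v (unlabeled (obs X S Y R 0 ω)) * u' (unlabeled (obs X S Y R 0 ω))
            - v (unlabeled (obs X S Y R 0 ω)) * v' (unlabeled (obs X S Y R 0 ω))) ∂μ := by
  obtain ⟨C, hC⟩ := hd.exists_one_div_rho_le
  let T : Ω → Vec p × Vec K × ℝ := fun ω => unlabeled (obs X S Y R 0 ω)
  have hTm : Measurable T := measurable_unlabeled.comp (hd.measurable_obs 0)
  let q : Vec p × Vec K × ℝ → ℝ := fun x => 1 / ρ x.1 x.2.1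
  have hq : Measurable q :=
    measurable_const.div (hd.measurable_rho.comp
      (by fun_prop : Measurable fun x : Vec p × Vec K × ℝ => (x.1, x.2.1)))
  have hqb : ∀ {g : Ω → ℝ}, Integrable g μ → Integrable (fun ω => q (T ω) * g ω) μ := fun hg =>
    hg.bdd_mul (hq.comp hTm).aestronglyMeasurable (Eventually.of_forall fun ω => by
      rw [Real.norm_of_nonneg (one_div_pos.2 (hd.rho_pos _ _)).le]
      exact hC _ _)
  have hWb : ∀ {g : Ω → ℝ}, Integrable g μ →
      Integrable (fun ω => ipWeight ρ (obs X S Y R 0 ω) * g ω) μ := fun hg =>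
    hg.bdd_mul (hd.measurable_ipWeight.comp (hd.measurable_obs 0)).aestronglyMeasurable
      (Eventually.of_forall fun ω => by
        rw [Real.norm_of_nonneg (hd.ipWeight_nonneg 0 ω)]
        exact hd.ipWeight_le hC 0 ω)
  have iuu : Integrable (fun ω => u (T ω) * u' (T ω)) μ := hu2.integrable_mul hu2'
  have iuv : Integrable (fun ω => u (T ω) * v' (T ω)) μ := hu2.integrable_mul hv2'
  have ivu : Integrable (fun ω => v (T ω) * u' (T ω)) μ := hv2.integrable_mul hu2'
  have ivv : Integrable (fun ω => v (T ω) * v' (T ω)) μ := hv2.integrable_mul hv2'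
  have imix : Integrable
      (fun ω => u (T ω) * v' (T ω) + v (T ω) * u' (T ω) - v (T ω) * v' (T ω)) μ :=
    (iuv.add ivu).sub ivv
  have idiff : Integrable (fun ω =>
      q (T ω) * (u (T ω) * v' (T ω) + v (T ω) * u' (T ω) - v (T ω) * v' (T ω))
        - (u (T ω) * v' (T ω) + v (T ω) * u' (T ω) - v (T ω) * v' (T ω))) μ :=
    (hqb imix).sub imix
  -- the coefficient of `W` in the product
  let f : Vec p × Vec K × ℝ → ℝ := fun x => q x * (u x * u' x)
    - (q x * (u x * v' x + v x * u' x - v x * v' x) - (u x * v' x + v x * u' x - v x * v' x))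
    - v x * v' x
  have hf : Measurable f := by fun_prop
  have ifT : Integrable (fun ω => f (T ω)) μ :=
    ((hqb iuu).sub idiff).sub ivv
  have hprod : ∀ ω, (ipWeight ρ (obs X S Y R 0 ω) * u (T ω)
          + (1 - ipWeight ρ (obs X S Y R 0 ω)) * v (T ω))
        * (ipWeight ρ (obs X S Y R 0 ω) * u' (T ω)
          + (1 - ipWeight ρ (obs X S Y R 0 ω)) * v' (T ω))
      = ipWeight ρ (obs X S Y R 0 ω) * f (T ω) + v (T ω) * v' (T ω) := fun ω => by
    have hsq : ipWeight ρ (obs X S Y R 0 ω) ^ 2 = ipWeight ρ (obs X S Y R 0 ω) * q (T ω) :=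
      hd.ipWeight_sq 0 ω
    simp only [f]
    linear_combination (u (T ω) * u' (T ω) - u (T ω) * v' (T ω) - v (T ω) * u' (T ω)
      + v (T ω) * v' (T ω)) * hsq
  have hcoef : ∀ ω, (1 - ρ (X 0 ω) (S 0 ω)) / ρ (X 0 ω) (S 0 ω) = q (T ω) - 1 := fun ω => by
    rw [sub_div, div_self (hd.rho_pos _ _).ne']
    rfl
  calc _ = ∫ ω, ipWeight ρ (obs X S Y R 0 ω) * f (T ω) + v (T ω) * v' (T ω) ∂μ :=
        integral_congr_ae (Eventually.of_forall hprod)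
    _ = ∫ ω, f (T ω) ∂μ + ∫ ω, v (T ω) * v' (T ω) ∂μ := by
        rw [integral_add (hWb ifT) ivv]
        congr 1
        exact hd.integral_ipWeight_mul (f := fun w => f (unlabeled w)) (fun _ => rfl) hf
    _ = ∫ ω, q (T ω) * (u (T ω) * u' (T ω)) - (q (T ω) *
          (u (T ω) * v' (T ω) + v (T ω) * u' (T ω) - v (T ω) * v' (T ω))
          - (u (T ω) * v' (T ω) + v (T ω) * u' (T ω) - v (T ω) * v' (T ω))) ∂μ := by
        rw [← integral_add ifT ivv]
        refine integral_congr_ae (Eventually.of_forall fun ω => ?_)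
        simp only [f]
        ring
    _ = _ := by
        rw [integral_sub (hqb iuu) idiff]
        congr 1
        refine integral_congr_ae (Eventually.of_forall fun ω => ?_)
        simp only [hcoef]
        simp only [T]
        ring

/-- The variance of the influence function of the surrogate-powered estimator. -/
theorem covMatrix_spiInfluence (hd : IsPoissonDesign μ X S Y R ρ) {d : ℕ}
    (Γ : Matrix (Fin p) (Fin K × Fin d) ℝ) {ψ : Obs p K → Vec p} {η : Obs p K → StackedVec K d}
    {ψ' : Vec p × Vec K × ℝ → Vec p} {γ' : Vec p × Vec K × ℝ → Vec p}
    (hψ : ∀ w, ψ w = ψ' (unlabeled w)) (hγ : ∀ w, matVec Γ (η w) = γ' (unlabeled w))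
    (hψm : Measurable ψ') (hγm : Measurable γ')
    (hψ2 : MemLp (fun ω => ψ (obs X S Y R 0 ω)) 2 μ)
    (hγ2 : MemLp (fun ω => matVec Γ (η (obs X S Y R 0 ω))) 2 μ)
    (hmem : MemLp (fun ω => spiInfluence ρ Γ ψ η (obs X S Y R 0 ω)) 2 μ)
    (hmean : ∫ ω, spiInfluence ρ Γ ψ η (obs X S Y R 0 ω) ∂μ = 0) :
    covMatrix μ (fun ω => spiInfluence ρ Γ ψ η (obs X S Y R 0 ω)) =
      matExp μ (fun ω => (1 / ρ (X 0 ω) (S 0 ω)) •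
          outer (ψ (obs X S Y R 0 ω)) (ψ (obs X S Y R 0 ω)))
      - matExp μ (fun ω => ((1 - ρ (X 0 ω) (S 0 ω)) / ρ (X 0 ω) (S 0 ω)) •
          (outer (ψ (obs X S Y R 0 ω)) (η (obs X S Y R 0 ω)) * Γ.transpose
            + Γ * outer (η (obs X S Y R 0 ω)) (ψ (obs X S Y R 0 ω))
            - Γ * outer (η (obs X S Y R 0 ω)) (η (obs X S Y R 0 ω)) * Γ.transpose)) := by
  have hcoord : ∀ {V : Ω → Vec p}, MemLp V 2 μ → ∀ a, MemLp (fun ω => V ω a) 2 μ := fun hV a =>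
    (EuclideanSpace.proj (𝕜 := ℝ) a).comp_memLp' hV
  have hmean' : ∀ a, ∫ ω, spiInfluence ρ Γ ψ η (obs X S Y R 0 ω) a ∂μ = 0 := fun a => by
    have := (EuclideanSpace.proj (𝕜 := ℝ) a).integral_comp_comm (hmem.integrable (by norm_num))
    simpa [hmean] using this
  have hψc : ∀ a : Fin p, Measurable fun x => ψ' x a := fun a =>
    (EuclideanSpace.proj (𝕜 := ℝ) a).measurable.comp hψm
  have hγc : ∀ a : Fin p, Measurable fun x => γ' x a := fun a =>
    (EuclideanSpace.proj (𝕜 := ℝ) a).measurable.comp hγm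
  have hmul : ∀ w a, Γ.mulVec (η w).ofLp a = γ' (unlabeled w) a := fun w a => by
    rw [← hγ w]; rfl
  simp_rw [hψ] at hψ2
  simp_rw [hγ] at hγ2
  ext a b
  have key := hd.integral_mul_ipWeight_comb (hψc a) (hψc b) (hγc a) (hγc b) (hcoord hψ2 a)
    (hcoord hψ2 b) (hcoord hγ2 a) (hcoord hγ2 b)
  simp only [covMatrix, matExp, outer, Matrix.sub_apply, Matrix.of_apply, Matrix.smul_apply,
    Matrix.add_apply, Matrix.mul_vecMulVec, Matrix.vecMulVec_mul, Matrix.vecMul_transpose,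
    Matrix.vecMulVec_apply, hmul, smul_eq_mul]
  rw [covariance_eq_sub (hcoord hmem a) (hcoord hmem b), hmean' a, zero_mul, sub_zero]
  simp only [Pi.mul_apply, spiInfluence_eq hd.rho_pos, hψ, hγ]
  exact key

/-- The influence function of the surrogate-powered estimator, from those of its ingredients. -/
theorem isInfluenceFunction_spi (hd : IsPoissonDesign μ X S Y R ρ) {d : ℕ}
    (Γ : Matrix (Fin p) (Fin K × Fin d) ℝ) {ψ : Obs p K → Vec p} {η : Fin K → Obs p K → Vec d}
    {β₀ : Vec p} {θ₀ : Fin K → Vec d} {βV : ℕ → Ω → Vec p} {θV θF : Fin K → ℕ → Ω → Vec d}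
    (hβV : IsInfluenceFunction μ (obs X S Y R) βV β₀ fun w => ipWeight ρ w • ψ w)
    (hθV : ∀ k, IsInfluenceFunction μ (obs X S Y R) (θV k) (θ₀ k) fun w => ipWeight ρ w • η k w)
    (hθF : ∀ k, IsInfluenceFunction μ (obs X S Y R) (θF k) (θ₀ k) (η k)) :
    IsInfluenceFunction μ (obs X S Y R) (spiEstimator Γ βV θV θF) β₀
      (spiInfluence ρ Γ ψ fun w => stack fun k => η k w) := by
  have h := hβV.sub (IsInfluenceFunction.sum Finset.univ fun k =>
    ((hθV k).sub (hθF k)).clm_apply (blockCLM Γ k))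
  have hest : (fun N ω => βV N ω - ∑ k, blockCLM Γ k (θV k N ω - θF k N ω))
      = spiEstimator Γ βV θV θF := by
    ext1 N; ext1 ω
    rw [spiEstimator, stack_sub, matVec_stack]
  have hval : β₀ - ∑ k, blockCLM Γ k (θ₀ k - θ₀ k) = β₀ := by simp
  have hφ : (fun w => ipWeight ρ w • ψ w - ∑ k, blockCLM Γ k (ipWeight ρ w • η k w - η k w))
      = spiInfluence ρ Γ ψ fun w => stack fun k => η k w := by
    ext1 w
    rw [spiInfluence_eq hd.rho_pos, matVec_stack, sub_eq_add_neg, ← Finset.sum_neg_distrib,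
      Finset.smul_sum]
    congr 1
    refine Finset.sum_congr rfl fun k _ => ?_
    rw [map_sub, map_smul, sub_smul, one_smul, neg_sub]
  rwa [hest, hval, hφ] at h

end IsPoissonDesign

lemma measurable_fullInfluence {e : ℕ} {Z : Type*} [MeasurableSpace Z] {ν : Measure Z}
    {g : Vec e → Z → Vec e} {t₀ : Vec e} (hg : Measurable (g t₀)) :
    Measurable (fullInfluence ν g t₀) :=
  ((∫ z, fderiv ℝ (fun t => g t z) t₀ ∂ν).inverse.measurable.comp hg).neg

end SPI

end

theorem lemma1 {Ω : Type*} [MeasurableSpace Ω] (μ : Measure Ω) [IsProbabilityMeasure μ]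
    {p K d : ℕ}
    -- the data and the labeling rule
    (X : ℕ → Ω → SPI.Vec p) (S : ℕ → Ω → SPI.Vec K) (Y R : ℕ → Ω → ℝ)
    (ρ : SPI.Vec p → SPI.Vec K → ℝ) (hdesign : SPI.IsPoissonDesign μ X S Y R ρ)
    -- the target parameter and the nuisance parameters
    (m : SPI.Vec p → ℝ × SPI.Vec p → SPI.Vec p) (Bβ : Set (SPI.Vec p)) (β₀ : SPI.Vec p)
    (hm : SPI.IsRegular (μ.map (fun ω => (Y 0 ω, X 0 ω))) m Bβ β₀)
    (h : SPI.Vec d → ℝ × SPI.Vec p → SPI.Vec d) (Bθ : Fin K → Set (SPI.Vec d))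
    (θ₀ : Fin K → SPI.Vec d)
    (hh : ∀ k, SPI.IsRegular (μ.map (fun ω => (S 0 ω k, X 0 ω))) h (Bθ k) (θ₀ k))
    -- the estimators
    (βV : ℕ → Ω → SPI.Vec p) (θV θF : Fin K → ℕ → Ω → SPI.Vec d)
    (hβV : SPI.IsSolution μ Bβ (SPI.validationEq X S Y R ρ SPI.labelData m) βV)
    (hθV : ∀ k, SPI.IsSolution μ (Bθ k)
      (SPI.validationEq X S Y R ρ (SPI.surrogateData k) h) (θV k))
    (hθF : ∀ k, SPI.IsSolution μ (Bθ k) (SPI.fullEq X S Y R (SPI.surrogateData k) h) (θF k))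
    (Γ : Matrix (Fin p) (Fin K × Fin d) ℝ)
    -- `ψ`, `η`, `ψ̃`, `β̂` and `r`
    (ψ : SPI.Obs p K → SPI.Vec p) (η : SPI.Obs p K → SPI.StackedVec K d)
    (ψt : SPI.Obs p K → SPI.Vec p) (βhat : ℕ → Ω → SPI.Vec p) (r : ℝ)
    (hψ : ψ = fun w =>
      SPI.fullInfluence (μ.map (fun ω => (Y 0 ω, X 0 ω))) m β₀ (SPI.labelData w))
    (hη : η = fun w => SPI.stack fun k =>
      SPI.fullInfluence (μ.map (fun ω => (S 0 ω k, X 0 ω))) h (θ₀ k) (SPI.surrogateData k w))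
    (hψt : ψt = SPI.spiInfluence ρ Γ ψ η)
    (hβhat : βhat = SPI.spiEstimator Γ βV θV θF)
    (hr : r = ∫ ω, ρ (X 0 ω) (S 0 ω) ∂μ) :
    -- asymptotic normality, with `n = |𝒱|`
    TendstoInDistribution
      (fun (N : ℕ) ω => √((SPI.validationSet R N ω).card : ℝ) • (βhat N ω - β₀)) atTop
      (fun v : SPI.Vec p => v) (fun _ => μ)
      (multivariateGaussian 0 (r • SPI.covMatrix μ (fun ω => ψt (SPI.obs X S Y R 0 ω)))) ∧
    -- `ψ̃` is the influence function of `β̂`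
    SPI.IsInfluenceFunction μ (SPI.obs X S Y R) βhat β₀ ψt ∧
    -- `ψ` and `η⁽ᵏ⁾` are the influence functions of the full data estimators
    (∀ βF : ℕ → Ω → SPI.Vec p,
      SPI.IsSolution μ Bβ (SPI.fullEq X S Y R SPI.labelData m) βF →
      SPI.IsInfluenceFunction μ (SPI.obs X S Y R) βF β₀ ψ) ∧
    (∀ k, SPI.IsInfluenceFunction μ (SPI.obs X S Y R) (θF k) (θ₀ k)
      (fun w => WithLp.toLp 2 fun j => η w (k, j))) ∧
    -- the explicit form of the asymptotic variance
    SPI.covMatrix μ (fun ω => ψt (SPI.obs X S Y R 0 ω)) =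
      SPI.matExp μ (fun ω =>
        (1 / ρ (X 0 ω) (S 0 ω)) •
          SPI.outer (ψ (SPI.obs X S Y R 0 ω)) (ψ (SPI.obs X S Y R 0 ω)))
      - SPI.matExp μ (fun ω =>
        ((1 - ρ (X 0 ω) (S 0 ω)) / ρ (X 0 ω) (S 0 ω)) •
          (SPI.outer (ψ (SPI.obs X S Y R 0 ω)) (η (SPI.obs X S Y R 0 ω)) * Γ.transpose
            + Γ * SPI.outer (η (SPI.obs X S Y R 0 ω)) (ψ (SPI.obs X S Y R 0 ω))
            - Γ * SPI.outer (η (SPI.obs X S Y R 0 ω)) (η (SPI.obs X S Y R 0 ω))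
                * Γ.transpose)) := by
  have hlabel : μ.map (fun ω => (Y 0 ω, X 0 ω))
      = (μ.map (SPI.obs X S Y R 0)).map SPI.labelData := by
    rw [Measure.map_map SPI.measurable_labelData (hdesign.measurable_obs 0)]
    rfl
  have hsurr : ∀ k, μ.map (fun ω => (S 0 ω k, X 0 ω))
      = (μ.map (SPI.obs X S Y R 0)).map (SPI.surrogateData k) := fun k => by
    rw [Measure.map_map (SPI.measurable_surrogateData k) (hdesign.measurable_obs 0)]
    rfl
  obtain ⟨ηk, hηk⟩ : ∃ ηk : Fin K → SPI.Obs p K → SPI.Vec d, ∀ k, ηk k = fun w =>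
      SPI.fullInfluence (μ.map (fun ω => (S 0 ω k, X 0 ω))) h (θ₀ k) (SPI.surrogateData k w) :=
    ⟨_, fun _ => rfl⟩
  have hη' : η = fun w => SPI.stack fun k => ηk k w := by
    rw [hη]
    simp only [hηk]
  have IβV : SPI.IsInfluenceFunction μ (SPI.obs X S Y R) βV β₀
      fun w => SPI.ipWeight ρ w • ψ w := by
    rw [hψ, hlabel]
    rw [hlabel] at hm
    exact hdesign.isInfluenceFunction_validation
      (z' := fun x : SPI.Vec p × SPI.Vec K × ℝ => (x.2.2, x.1)) (by fun_prop) rfl hm hβV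
  have IθV : ∀ k, SPI.IsInfluenceFunction μ (SPI.obs X S Y R) (θV k) (θ₀ k)
      fun w => SPI.ipWeight ρ w • ηk k w := fun k => by
    have hk := hh k
    rw [hsurr k] at hk
    rw [hηk k, hsurr k]
    exact hdesign.isInfluenceFunction_validation
      (z' := fun x : SPI.Vec p × SPI.Vec K × ℝ => (x.2.1 k, x.1)) (by fun_prop) rfl hk (hθV k)
  have IθF : ∀ k, SPI.IsInfluenceFunction μ (SPI.obs X S Y R) (θF k) (θ₀ k) (ηk k) := fun k => by
    have hk := hh k
    rw [hsurr k] at hk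
    rw [hηk k, hsurr k]
    exact hdesign.isInfluenceFunction_full (SPI.measurable_surrogateData k) hk (hθF k)
  have Iβ : SPI.IsInfluenceFunction μ (SPI.obs X S Y R) βhat β₀ ψt := by
    rw [hβhat, hψt, hη']
    exact hdesign.isInfluenceFunction_spi Γ IβV IθV IθF
  have hγ : ∀ w, SPI.matVec Γ (η w) = ∑ k, SPI.blockCLM Γ k (ηk k w) := fun w => by
    rw [hη', SPI.matVec_stack]
  obtain ⟨ψ', hψm, hψ'⟩ : ∃ ψ' : SPI.Vec p × SPI.Vec K × ℝ → SPI.Vec p, Measurable ψ' ∧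
      ∀ w, ψ w = ψ' (SPI.unlabeled w) := by
    refine ⟨fun x => SPI.fullInfluence (μ.map (fun ω => (Y 0 ω, X 0 ω))) m β₀ (x.2.2, x.1),
      (SPI.measurable_fullInfluence (hm.measurable β₀)).comp (by fun_prop), fun w => ?_⟩
    rw [hψ]
    rfl
  obtain ⟨γ', hγm, hγ'⟩ : ∃ γ' : SPI.Vec p × SPI.Vec K × ℝ → SPI.Vec p, Measurable γ' ∧
      ∀ w, SPI.matVec Γ (η w) = γ' (SPI.unlabeled w) := by
    have hmk : ∀ k, Measurable fun x : SPI.Vec p × SPI.Vec K × ℝ =>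
        SPI.fullInfluence (μ.map (fun ω => (S 0 ω k, X 0 ω))) h (θ₀ k) (x.2.1 k, x.1) := fun k =>
      (SPI.measurable_fullInfluence ((hh k).measurable (θ₀ k))).comp (by fun_prop)
    refine ⟨_, Finset.measurable_fun_sum Finset.univ fun k _ =>
      (SPI.blockCLM Γ k).measurable.comp (hmk k), fun w => ?_⟩
    rw [hγ]
    simp only [hηk]
    rfl
  have hψw : Measurable ψ := by
    rw [funext hψ']; exact hψm.comp SPI.measurable_unlabeled
  have hγw : Measurable fun w => SPI.matVec Γ (η w) := by
    rw [funext hγ']; exact hγm.comp SPI.measurable_unlabeled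
  have hψtm : Measurable ψt := by
    rw [hψt, funext (SPI.spiInfluence_eq hdesign.rho_pos Γ ψ η)]
    exact (hdesign.measurable_ipWeight.smul hψw).add
      ((measurable_const.sub hdesign.measurable_ipWeight).smul hγw)
  have hβm : ∀ N, AEMeasurable (βhat N) μ := fun N => by
    have hsum : βhat N = fun ω => βV N ω - ∑ k, SPI.blockCLM Γ k (θV k N ω - θF k N ω) := by
      rw [hβhat]
      ext1 ω
      rw [SPI.spiEstimator, SPI.stack_sub, SPI.matVec_stack]
    rw [hsum]
    exact (hβV.aemeasurable N).sub (Finset.aemeasurable_fun_sum _ fun k _ =>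
      (SPI.blockCLM Γ k).measurable.comp_aemeasurable
        (((hθV k).aemeasurable N).sub ((hθF k).aemeasurable N)))
  have hIfull : ∀ βF : ℕ → Ω → SPI.Vec p,
      SPI.IsSolution μ Bβ (SPI.fullEq X S Y R SPI.labelData m) βF →
      SPI.IsInfluenceFunction μ (SPI.obs X S Y R) βF β₀ ψ := fun βF hβF => by
    rw [hψ, hlabel]
    rw [hlabel] at hm
    exact hdesign.isInfluenceFunction_full SPI.measurable_labelData hm hβF
  have hψ2 : MemLp (fun ω => ψ (SPI.obs X S Y R 0 ω)) 2 μ := by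
    have := hm.memLp_fullInfluence.comp_of_map
      ((hdesign.measurable_Y 0).prodMk (hdesign.measurable_X 0)).aemeasurable
    rw [hψ]
    exact this
  refine ⟨?_, Iβ, hIfull, fun k => ?_, ?_⟩
  · have hr0 : 0 ≤ r := by
      rw [hr]; exact integral_nonneg fun ω => (hdesign.rho_pos _ _).le
    refine SPI.tendstoInDistribution_random_norm hdesign.isIIDSample Iβ
      hψtm.aestronglyMeasurable hβm
      (n := fun N ω => ((SPI.validationSet R N ω).card : ℝ)) (fun N => ?_) (fun ω => ?_) hr0 ?_
    · simp_rw [hdesign.card_validationSet]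
      exact (Finset.measurable_fun_sum _ fun i _ => hdesign.measurable_R i).aemeasurable
    · simp [SPI.validationSet]
    · have hRm : Measurable fun w : SPI.Obs p K => w.2.2.2 := by fun_prop
      have hRi : Integrable (fun w : SPI.Obs p K => w.2.2.2) (μ.map (SPI.obs X S Y R 0)) :=
        (integrable_map_measure hRm.aestronglyMeasurable
          (hdesign.measurable_obs 0).aemeasurable).2 (hdesign.integrable_R 0)
      have hlln := hdesign.isIIDSample.tendstoInMeasure_average hRi
      rw [integral_map (hdesign.measurable_obs 0).aemeasurable hRm.aestronglyMeasurable] at hlln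
      have hmean : ∫ ω, (SPI.obs X S Y R 0 ω).2.2.2 ∂μ = r := by
        rw [hr]; exact hdesign.integral_R 0
      rw [hmean] at hlln
      simp_rw [hdesign.card_validationSet]
      exact hlln
  · have hηk' : (fun w => WithLp.toLp 2 fun j => η w (k, j)) = ηk k := by
      rw [hη']
      rfl
    rw [hηk']
    exact IθF k
  · subst hψt
    refine hdesign.covMatrix_spiInfluence Γ hψ' hγ' hψm hγm hψ2 ?_ (Iβ.memLp 0) (Iβ.mean_zero 0)
    simp_rw [hγ]
    exact memLp_finsetSum _ fun k _ => (SPI.blockCLM Γ k).comp_memLp' ((IθF k).memLp 0)
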